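/- Let $k$ be a field. An integral non-degenerate curve $\Gamma\subset\mathbb P^r_k$ is given by its homogeneous prime ideal $I(\Gamma)\subset k[X_0,\dots,X_r]$, where the homogeneous coordinate ring $k[\Gamma]=k[X_0,\dots,X_r]/I(\Gamma)$ has Krull dimension $2$ and $I(\Gamma)$ contains no non-zero linear form. For a closed point $P$ of $\Gamma=\operatorname{Proj}k[\Gamma]$ let $\mathcal O_{\Gamma,P}$ be the local ring of $\Gamma$ at $P$ and $\overline{\mathcal O_{\Gamma,P}}$ its normalization (the integral closure in its field of fractions). Put $$\delta_P(\Gamma)=\dim_k\,\overline{\mathcal O_{\Gamma,P}}/\mathcal O_{\Gamma,P},\qquad \delta(\Gamma)=\sum_{P\in\operatorname{Sing}(\Gamma)}\delta_P(\Gamma),$$ both read in $\mathbb N\cup\{\infty\}$, where $\operatorname{Sing}(\Gamma)$ is the set of closed points $P$ of $\Gamma$ for which $\mathcal O_{\Gamma,P}$ is not a regular local ring. Let $\Gamma\subset\mathbb P^r_{\mathbb Q}$ be an integral non-degenerate curve, and let $p$ be a prime. Let $I(\Gamma)_p\subset\mathbb F_p[X_0,\dots,X_r]$ be the ideal generated by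 the reductions modulo $p$ of all elements of $I(\Gamma)\cap\mathbb Z[X_0,\dots,X_r]$. Suppose that $I(\Gamma)_p$ is radical and defines an integral non-degenerate curve $\Gamma_p\subset\mathbb P^r_{\mathbb F_p}$; that is, $I(\Gamma)_p$ is the homogeneous prime ideal $I(\Gamma_p)$ of such a curve. Then $$\delta(\Gamma)\leq\delta(\Gamma_p).$$ -/

import Mathlib

noncomputable section

open scoped DirectSum

/-! ### The grading of a quotient by a homogeneous ideal -/

section QuotientGrading

variable {k A : Type*} [CommRing k] [CommRing A] [Algebra k A]

/-- The degree `n` part of `A ⧸ I` is the image of the degree `n` part of `A`. -/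
def quotientGrading (𝒜 : ℕ → Submodule k A) (I : Ideal A) : ℕ → Submodule k (A ⧸ I) :=
  fun n => (𝒜 n).map (Ideal.Quotient.mkₐ k I).toLinearMap

theorem mk_mem_quotientGrading (𝒜 : ℕ → Submodule k A) (I : Ideal A) {n : ℕ} {a : A}
    (ha : a ∈ 𝒜 n) : Ideal.Quotient.mkₐ k I a ∈ quotientGrading 𝒜 I n :=
  ⟨a, ha, rfl⟩

instance quotientGrading_gradedMonoid (𝒜 : ℕ → Submodule k A) [GradedAlgebra 𝒜] (I : Ideal A) :
    SetLike.GradedMonoid (quotientGrading 𝒜 I) where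
  one_mem := ⟨1, SetLike.GradedOne.one_mem, map_one (Ideal.Quotient.mkₐ k I)⟩
  mul_mem := by
    rintro i j _ _ ⟨a, ha, rfl⟩ ⟨b, hb, rfl⟩
    exact ⟨a * b, SetLike.GradedMul.mul_mem ha hb, map_mul (Ideal.Quotient.mkₐ k I) a b⟩

/-- The decomposition of an element of `A` into its homogeneous components, reduced modulo `I`. -/
def decomposeMod (𝒜 : ℕ → Submodule k A) [GradedAlgebra 𝒜] (I : Ideal A) :
    A →ₐ[k] ⨁ n, quotientGrading 𝒜 I n :=
  (DirectSum.toAlgebra k (fun n => 𝒜 n)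
    (fun n => (DirectSum.lof k ℕ (fun n => quotientGrading 𝒜 I n) n).comp
      ((Ideal.Quotient.mkₐ k I).toLinearMap.restrict
        (fun _ ha => mk_mem_quotientGrading 𝒜 I ha)))
    rfl
    (fun {i j} a b => by
      change DirectSum.of (fun n => quotientGrading 𝒜 I n) _ _ =
        DirectSum.of (fun n => quotientGrading 𝒜 I n) _ _ *
          DirectSum.of (fun n => quotientGrading 𝒜 I n) _ _
      rw [DirectSum.of_mul_of]
      congr 1)).comp
  (DirectSum.decomposeAlgEquiv 𝒜).toAlgHom

theorem decomposeMod_of_mem (𝒜 : ℕ → Submodule k A) [GradedAlgebra 𝒜] (I : Ideal A)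
    {n : ℕ} {a : A} (ha : a ∈ 𝒜 n) :
    decomposeMod 𝒜 I a = DirectSum.of (fun n => quotientGrading 𝒜 I n) n
      ⟨Ideal.Quotient.mkₐ k I a, mk_mem_quotientGrading 𝒜 I ha⟩ := by
  have h : DirectSum.decompose 𝒜 a = DirectSum.of (fun n => 𝒜 n) n ⟨a, ha⟩ :=
    DirectSum.decompose_of_mem 𝒜 ha
  rw [decomposeMod, AlgHom.comp_apply]
  change DirectSum.toAlgebra _ _ _ _ _ (DirectSum.decompose 𝒜 a) = _
  rw [h]
  exact DirectSum.toAddMonoid_of _ _ _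

theorem decomposeMod_eq_zero (𝒜 : ℕ → Submodule k A) [GradedAlgebra 𝒜] {I : Ideal A}
    (hI : I.IsHomogeneous 𝒜) {a : A} (ha : a ∈ I) : decomposeMod 𝒜 I a = 0 := by
  classical
  rw [← DirectSum.sum_support_decompose 𝒜 a, map_sum]
  refine Finset.sum_eq_zero fun n _ => ?_
  rw [decomposeMod_of_mem 𝒜 I (SetLike.coe_mem _)]
  have h0 : Ideal.Quotient.mkₐ k I (DirectSum.decompose 𝒜 a n : A) = 0 :=
    Ideal.Quotient.eq_zero_iff_mem.mpr (hI n ha)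
  rw [show (⟨Ideal.Quotient.mkₐ k I (DirectSum.decompose 𝒜 a n : A), _⟩ :
    quotientGrading 𝒜 I n) = 0 from Subtype.ext h0, map_zero]

/-- The quotient of a graded algebra by a homogeneous ideal is graded. -/
@[reducible] def quotientGradedAlgebra (𝒜 : ℕ → Submodule k A) [GradedAlgebra 𝒜] {I : Ideal A}
    (hI : I.IsHomogeneous 𝒜) : GradedAlgebra (quotientGrading 𝒜 I) :=
  GradedAlgebra.ofAlgHom (quotientGrading 𝒜 I)
    (Ideal.Quotient.liftₐ I (decomposeMod 𝒜 I) (fun _ ha => decomposeMod_eq_zero 𝒜 hI ha))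
    (by
      classical
      apply Ideal.Quotient.algHom_ext
      ext a
      change DirectSum.coeAlgHom (quotientGrading 𝒜 I) (decomposeMod 𝒜 I a) =
        Ideal.Quotient.mkₐ k I a
      conv_lhs => rw [← DirectSum.sum_support_decompose 𝒜 a]
      conv_rhs => rw [← DirectSum.sum_support_decompose 𝒜 a]
      rw [map_sum, map_sum, map_sum]
      refine Finset.sum_congr rfl fun n _ => ?_
      rw [decomposeMod_of_mem 𝒜 I (SetLike.coe_mem _), DirectSum.coeAlgHom_of])
    (by
      rintro n ⟨_, a, ha, rfl⟩
      exact decomposeMod_of_mem 𝒜 I ha)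

end QuotientGrading

/-- The `k`-algebra structure of a homogeneous localization of a graded `k`-algebra
(extending the scalar multiplication already present there). -/
instance homogeneousLocalizationBaseAlgebra {k A : Type*} [CommRing k] [CommRing A] [Algebra k A]
    (𝒜 : ℕ → Submodule k A) [GradedAlgebra 𝒜] (x : Submonoid A) :
    Algebra k (HomogeneousLocalization 𝒜 x) where
  algebraMap := (HomogeneousLocalization.fromZeroRingHom 𝒜 x).comp (algebraMap k (𝒜 0))
  commutes' _ _ := mul_comm _ _
  smul_def' c y := by
    apply HomogeneousLocalization.val_injective
    rw [HomogeneousLocalization.val_smul, HomogeneousLocalization.val_mul, Algebra.smul_def]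
    rfl

/-! ### The delta invariant -/

/-- `δ_k(A) = dim_k (Ā / A)`, where `Ā` is the normalization of `A`, that is, its integral closure
in its total ring of fractions. It is an element of `ℕ∞`, with value `⊤` if the dimension is
infinite. -/
def deltaInvariant (k A : Type*) [Field k] [CommRing A] [Algebra k A] : ℕ∞ :=
  Cardinal.toENat (Module.rank k
    (integralClosure A (FractionRing A) ⧸
      LinearMap.range (Algebra.linearMap A (integralClosure A (FractionRing A)))))

attribute [local instance] MvPolynomial.gradedAlgebra

/-- An integral non-degenerate curve `Γ` in `ℙ^r` over `k`, given by its homogeneous ideal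
`I(Γ) ⊆ k[X_0, …, X_r]`. -/
structure ProjectiveCurve (k : Type*) [Field k] (r : ℕ) where
  /-- The homogeneous ideal `I(Γ)`. -/
  ideal : Ideal (MvPolynomial (Fin (r + 1)) k)
  isHomogeneous : ideal.IsHomogeneous (MvPolynomial.homogeneousSubmodule (Fin (r + 1)) k)
  /-- `Γ` is integral. -/
  isPrime : ideal.IsPrime
  /-- `Γ` has dimension one, that is, its affine cone has dimension two. -/
  dim_eq : ringKrullDim (MvPolynomial (Fin (r + 1)) k ⧸ ideal) = 2
  /-- `Γ` is non-degenerate: it is not contained in a hyperplane. -/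
  nondegenerate : ∀ f ∈ ideal, f.IsHomogeneous 1 → f = 0

namespace ProjectiveCurve

variable {k : Type*} [Field k] {r : ℕ}

/-- The homogeneous coordinate ring `k[Γ] = k[X_0, …, X_r] / I(Γ)`. -/
abbrev coordinateRing (Γ : ProjectiveCurve k r) : Type _ :=
  MvPolynomial (Fin (r + 1)) k ⧸ Γ.ideal

/-- The grading of `k[Γ]` by degree. -/
def grading (Γ : ProjectiveCurve k r) : ℕ → Submodule k Γ.coordinateRing :=
  quotientGrading (MvPolynomial.homogeneousSubmodule (Fin (r + 1)) k) Γ.ideal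

instance (Γ : ProjectiveCurve k r) : GradedAlgebra Γ.grading :=
  quotientGradedAlgebra (MvPolynomial.homogeneousSubmodule (Fin (r + 1)) k) Γ.isHomogeneous

/-- The (closed) points of `Γ = Proj k[Γ]`. -/
def Point (Γ : ProjectiveCurve k r) : Type _ :=
  {P : ProjectiveSpectrum Γ.grading // IsClosed ({P} : Set (ProjectiveSpectrum Γ.grading))}

/-- The local ring `𝒪_{Γ,P}`: the homogeneous localization of `k[Γ]` at `P`. -/
abbrev localRing (Γ : ProjectiveCurve k r) (P : Γ.Point) : Type _ :=
  HomogeneousLocalization.AtPrime Γ.grading P.1.asHomogeneousIdeal.toIdeal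

/-- The delta invariant `δ_P(Γ)` of `Γ` at a point `P`. -/
def deltaAt (Γ : ProjectiveCurve k r) (P : Γ.Point) : ℕ∞ :=
  deltaInvariant k (Γ.localRing P)

/-- The singular locus of `Γ`. -/
def singularLocus (Γ : ProjectiveCurve k r) : Set Γ.Point :=
  {P | ¬ IsRegularLocalRing (Γ.localRing P)}

/-- The global delta invariant `δ(Γ) = ∑_{P ∈ Sing Γ} δ_P(Γ)`. -/
def delta (Γ : ProjectiveCurve k r) : ℕ∞ :=
  ∑' P : Γ.singularLocus, Γ.deltaAt P

end ProjectiveCurve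

/-- The reduction `J_N` modulo `N` of an ideal `J` of `ℚ[X]`: the ideal of `(ℤ/N)[X]` generated by
the reductions of the elements of `J ∩ ℤ[X]`. -/
def reductionMod {σ : Type*} (J : Ideal (MvPolynomial σ ℚ)) (N : ℕ) :
    Ideal (MvPolynomial σ (ZMod N)) :=
  (J.comap (MvPolynomial.map (Int.castRingHom ℚ))).map (MvPolynomial.map (Int.castRingHom (ZMod N)))

end

/-! In a large degree `n`, `δ` measures how many homogeneous fractions of degree `n`, integral over
the coordinate ring, are independent modulo forms of degree `n`. The proof specialises such
fractions from `ℚ` to `𝔽_p` without losing independence. Only one inequality is needed on each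
fibre, and neither side is assumed finite.

On the generic fibre (`exists_sections_of_le_sum_deltaAt`), any `m ≤ ∑ δ_P` over finitely many
points gives, for every large `n`, fractions `w_1, …, w_m` independent modulo forms. A single form
`c ≠ 0`, independent of `n` and `j`, makes `c * v ^ j` a form for all `j` and all `v` in the span of
the `w_i` and the forms of degree `n`. Integrality thus becomes a family of divisibilities, which
can be reduced modulo `p`.

After scaling, `c` is integral and nonzero modulo `p` (`exists_smul_eq_ofInt_of_ne_zero`). In
`exists_reduction`, the `v` in that span for which `c * v` is an integral form make up a finitely
generated lattice. An integral basis of it modulo forms has at least `m` elements `v_i`. The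
reductions `G_i` of `c * v_i` stay independent modulo multiples of `c`, because the lattice contains
`y / p` whenever `c * y` is `p` times an integral form. The divisibilities `c ^ j ∣ c * G_i ^ j`
survive because `p` can be cancelled and the special coordinate ring is a domain
(`ofInt_dvd_ofInt`).

On the special fibre, these divisibilities make `G_i / c` almost integral, hence integral over a
noetherian ring. Dividing by powers of linear forms gives germs in the normalizations at all closed
points. A combination whose germs are all regular is divisible by `c` in large degree, so the germs
account for at least `m` dimensions of `δ(Γ_p)` (`eventually_le_delta`). -/

open scoped DirectSum

/-! ### Homogeneous fractions and their regularity at a prime -/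

section SectionsAt

variable {k A : Type*} [Field k] [CommRing A] [Algebra k A] (𝒜 : ℕ → Submodule k A)
  [GradedAlgebra 𝒜] (K : Type*) [Field K] [Algebra A K] [Algebra k K] [IsScalarTower k A K]

theorem algebraMap_smul_eq_smul_algebraMap (c : k) (a : A) :
    algebraMap A K (c • a) = c • algebraMap A K a := by
  rw [Algebra.algebraMap_eq_smul_one, smul_assoc, ← Algebra.algebraMap_eq_smul_one]

/-- The elements `a / b` of `K` where `b` is homogeneous and outside `P`, and `a` is homogeneous
with `deg a = deg b + n`. -/
def sectionsAt (P : Ideal A) [P.IsPrime] (n : ℕ) : Submodule k K where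
  carrier := {x | ∃ i, ∃ b ∈ 𝒜 i, b ∉ P ∧ ∃ a ∈ 𝒜 (i + n),
    algebraMap A K b * x = algebraMap A K a}
  zero_mem' := ⟨0, 1, SetLike.GradedOne.one_mem, P.one_notMem, 0, zero_mem _, by simp⟩
  add_mem' := by
    rintro x y ⟨i, b, hb, hbP, a, ha, hx⟩ ⟨j, d, hd, hdP, c, hc, hy⟩
    refine ⟨i + j, b * d, SetLike.GradedMul.mul_mem hb hd,
      fun h => (‹P.IsPrime›.mem_or_mem h).elim hbP hdP, d * a + b * c, add_mem ?_ ?_, ?_⟩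
    · rw [show i + j + n = j + (i + n) by ring]
      exact SetLike.GradedMul.mul_mem hd ha
    · rw [show i + j + n = i + (j + n) by ring]
      exact SetLike.GradedMul.mul_mem hb hc
    · rw [map_mul, map_add, map_mul, map_mul, ← hx, ← hy]
      ring
  smul_mem' := by
    rintro c x ⟨i, b, hb, hbP, a, ha, hx⟩
    exact ⟨i, b, hb, hbP, c • a, Submodule.smul_mem _ c ha, by
      rw [algebraMap_smul_eq_smul_algebraMap K, ← hx, mul_smul_comm]⟩

variable {K 𝒜}

theorem mem_sectionsAt {P : Ideal A} [P.IsPrime] {n : ℕ} {x : K} :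
    x ∈ sectionsAt 𝒜 K P n ↔ ∃ i, ∃ b ∈ 𝒜 i, b ∉ P ∧ ∃ a ∈ 𝒜 (i + n),
      algebraMap A K b * x = algebraMap A K a := Iff.rfl

theorem algebraMap_mem_sectionsAt (P : Ideal A) [P.IsPrime] {n : ℕ} {a : A} (ha : a ∈ 𝒜 n) :
    algebraMap A K a ∈ sectionsAt 𝒜 K P n :=
  ⟨0, 1, SetLike.GradedOne.one_mem, P.one_notMem, a, by rwa [zero_add], by simp⟩

theorem sectionsAt_mul_mem {P : Ideal A} [P.IsPrime] {m n : ℕ} {x y : K}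
    (hx : x ∈ sectionsAt 𝒜 K P m) (hy : y ∈ sectionsAt 𝒜 K P n) :
    x * y ∈ sectionsAt 𝒜 K P (m + n) := by
  obtain ⟨i, b, hb, hbP, a, ha, hx⟩ := hx
  obtain ⟨j, d, hd, hdP, c, hc, hy⟩ := hy
  refine ⟨i + j, b * d, SetLike.GradedMul.mul_mem hb hd,
    fun h => (‹P.IsPrime›.mem_or_mem h).elim hbP hdP, a * c, ?_, ?_⟩
  · rw [show i + j + (m + n) = (i + m) + (j + n) by ring]
    exact SetLike.GradedMul.mul_mem ha hc
  · rw [map_mul, map_mul, ← hx, ← hy]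
    ring

theorem sectionsAt_pow_mem {P : Ideal A} [P.IsPrime] {n : ℕ} {x : K}
    (hx : x ∈ sectionsAt 𝒜 K P n) (m : ℕ) : x ^ m ∈ sectionsAt 𝒜 K P (m * n) := by
  induction m with
  | zero =>
    simpa using algebraMap_mem_sectionsAt (𝒜 := 𝒜) (K := K) P (SetLike.GradedOne.one_mem)
  | succ m ih =>
    rw [pow_succ, Nat.succ_mul]
    exact sectionsAt_mul_mem ih hx

theorem mem_sectionsAt_of_mul_mem {P : Ideal A} [P.IsPrime] {m n : ℕ} {x : K} {l : A}
    (hl : l ∈ 𝒜 m) (hlP : l ∉ P) (h : algebraMap A K l * x ∈ sectionsAt 𝒜 K P (m + n)) :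
    x ∈ sectionsAt 𝒜 K P n := by
  obtain ⟨i, b, hb, hbP, a, ha, hx⟩ := h
  refine ⟨i + m, b * l, SetLike.GradedMul.mul_mem hb hl,
    fun h => (‹P.IsPrime›.mem_or_mem h).elim hbP hlP, a, by rwa [add_assoc], ?_⟩
  rw [map_mul, ← hx, mul_assoc]

theorem sectionsAt_le_of_le {P Q : Ideal A} [P.IsPrime] [Q.IsPrime] (h : P ≤ Q) (n : ℕ) :
    sectionsAt 𝒜 K Q n ≤ sectionsAt 𝒜 K P n := by
  rintro x ⟨i, b, hb, hbQ, hx⟩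
  exact ⟨i, b, hb, fun hbP => hbQ (h hbP), hx⟩

/-- If `c * x` is in `A` for a homogeneous fraction `x`, then so is the product with every
homogeneous component of `c`. -/
theorem decompose_mul_mem_of_mul_mem [IsDomain A] [FaithfulSMul A K] {n : ℕ} {x : K}
    (hx : x ∈ sectionsAt 𝒜 K (⊥ : Ideal A) n) {c y : A}
    (h : algebraMap A K c * x = algebraMap A K y) (j : ℕ) :
    algebraMap A K (DirectSum.decompose 𝒜 c j : A) * x =
      algebraMap A K (DirectSum.decompose 𝒜 y (j + n) : A) := by
  obtain ⟨i, b, hb, hb0, a, ha, hx⟩ := hx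
  have inj := FaithfulSMul.algebraMap_injective A K
  have h1 : a * c = b * y := by
    apply inj
    rw [map_mul, map_mul, ← hx, ← h]
    ring
  have h2 : a * (DirectSum.decompose 𝒜 c j : A) = b * (DirectSum.decompose 𝒜 y (j + n) : A) := by
    rw [← DirectSum.coe_decompose_mul_add_of_left_mem 𝒜 ha,
      ← DirectSum.coe_decompose_mul_add_of_left_mem 𝒜 hb, h1]
    rw [show i + n + j = i + (j + n) by ring]
  have hb0' : algebraMap A K b ≠ 0 := by
    rw [Ne, ← map_zero (algebraMap A K), inj.eq_iff]
    simpa using hb0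
  apply mul_left_cancel₀ hb0'
  rw [← map_mul, ← h2, map_mul, ← hx]
  ring

end SectionsAt

/-! ### Homogeneous primes in a graded domain of dimension two -/

section Homogeneous

variable {k A : Type*} [Field k] [CommRing A] [Algebra k A] {𝒜 : ℕ → Submodule k A}
  [GradedAlgebra 𝒜]

theorem Ideal.IsHomogeneous.exists_decompose_notMem {P : Ideal A} (a : A) (ha : a ∉ P) :
    ∃ i, (DirectSum.decompose 𝒜 a i : A) ∉ P := by
  classical
  by_contra! h
  apply ha
  rw [← DirectSum.sum_support_decompose 𝒜 a]
  exact Ideal.sum_mem _ fun i _ => h i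

theorem HomogeneousIdeal.exists_mem_notMem_of_not_le {I : Ideal A} (hI : I.IsHomogeneous 𝒜)
    {P : Ideal A} (h : ¬ I ≤ P) : ∃ i, ∃ a ∈ 𝒜 i, a ∈ I ∧ a ∉ P := by
  obtain ⟨a, haI, haP⟩ := Set.not_subset.mp h
  obtain ⟨i, hi⟩ := Ideal.IsHomogeneous.exists_decompose_notMem (𝒜 := 𝒜) a haP
  exact ⟨i, _, SetLike.coe_mem _, hI i haI, hi⟩

/-- In a graded domain of dimension two, a homogeneous prime ideal that does not contain the
irrelevant ideal contains no other nonzero prime ideal. -/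
theorem eq_of_le_of_ringKrullDim_eq_two [IsDomain A] (hdim : ringKrullDim A = 2) {P Q : Ideal A}
    [hP : P.IsPrime] (hPh : P.IsHomogeneous 𝒜)
    (hPirr : ¬ (HomogeneousIdeal.irrelevant 𝒜).toIdeal ≤ P) [hQ : Q.IsPrime] (hQ0 : Q ≠ ⊥)
    (hQP : Q ≤ P) : Q = P := by
  by_contra hne
  -- The degree-zero component of an equation `1 = a + b` would put `1` in `P`. A maximal ideal
  -- above the sum then extends `⊥ < Q < P` to a chain of length three.
  have hsup : P ⊔ (HomogeneousIdeal.irrelevant 𝒜).toIdeal ≠ ⊤ := by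
    rw [Ne, Ideal.eq_top_iff_one, Submodule.mem_sup]
    rintro ⟨a, ha, b, hb, hab⟩
    have hb0 : (DirectSum.decompose 𝒜 b 0 : A) = 0 := hb
    have ha0 : (DirectSum.decompose 𝒜 a 0 : A) ∈ P := hPh 0 ha
    apply P.one_notMem
    have h1 : (DirectSum.decompose 𝒜 (1 : A) 0 : A) = 1 :=
      DirectSum.decompose_of_mem_same 𝒜 SetLike.GradedOne.one_mem
    rw [← h1, ← hab, DirectSum.decompose_add]
    change (DirectSum.decompose 𝒜 a 0 : A) + (DirectSum.decompose 𝒜 b 0 : A) ∈ P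
    rwa [hb0, add_zero]
  obtain ⟨M, hM, hle⟩ := Ideal.exists_le_maximal _ hsup
  have hPM : P < M := lt_of_le_of_ne (le_sup_left.trans hle)
    fun h => hPirr (h ▸ le_sup_right.trans hle)
  have : M.IsPrime := hM.isPrime
  let s : LTSeries (PrimeSpectrum A) :=
    { length := 3
      toFun := ![⟨⊥, Ideal.isPrime_bot⟩, ⟨Q, hQ⟩, ⟨P, hP⟩, ⟨M, this⟩]
      step := by
        intro i
        fin_cases i
        · exact bot_lt_iff_ne_bot.mpr hQ0
        · exact lt_of_le_of_ne hQP hne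
        · exact hPM }
  have hs := Order.LTSeries.length_le_krullDim s
  change ((3 : ℕ) : WithBot ℕ∞) ≤ ringKrullDim A at hs
  rw [hdim] at hs
  exact absurd (WithBot.coe_le_coe.mp hs) (by decide)

/-- Powers of elements of `P` are divisible by `c` locally at `P`. -/
theorem exists_notMem_mul_pow_eq_mul [IsDomain A] (hdim : ringKrullDim A = 2) {P : Ideal A}
    [hP : P.IsPrime] (hPh : P.IsHomogeneous 𝒜)
    (hPirr : ¬ (HomogeneousIdeal.irrelevant 𝒜).toIdeal ≤ P) {i d : ℕ} {c z : A} (hc0 : c ≠ 0)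
    (hc : c ∈ 𝒜 i) (hzP : z ∈ P) (hz : z ∈ 𝒜 d) :
    ∃ e, ∃ t ∈ 𝒜 e, t ∉ P ∧ ∃ j a, t * z ^ j = c * a := by
  have key : ∃ t, t ∉ P ∧ ∃ j a, t * z ^ j = c * a := by
    -- Otherwise some prime `Q` contains `c` and avoids both the complement of `P` and the powers of
    -- `z`. It is nonzero and contained in `P`, so it equals `P`, which contains `z`.
    by_contra! h
    have hdisj : Disjoint (Ideal.span {c} : Set A)
        (P.primeCompl ⊔ Submonoid.powers z : Submonoid A) := by
      rw [Set.disjoint_left]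
      intro x hx hx'
      obtain ⟨a, rfl⟩ := Ideal.mem_span_singleton.mp hx
      obtain ⟨t, ht, y, ⟨j, rfl⟩, hty⟩ := Submonoid.mem_sup.mp hx'
      exact h t ht j a hty
    obtain ⟨Q, hQ, hcQ, hQd⟩ := Ideal.exists_le_prime_disjoint _ _ hdisj
    rw [Set.disjoint_left] at hQd
    have hQP : Q ≤ P := fun x hx => by
      by_contra hxP
      exact hQd hx (Submonoid.mem_sup_left (show x ∈ P.primeCompl from hxP))
    have hQ0 : Q ≠ ⊥ := by
      rintro rfl
      exact hc0 (by simpa using hcQ)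
    have := eq_of_le_of_ringKrullDim_eq_two hdim hPh hPirr hQ0 hQP
    subst this
    exact hQd hzP (Submonoid.mem_sup_right (Submonoid.mem_powers z))
  obtain ⟨t, ht, j, a, h⟩ := key
  obtain ⟨e, he⟩ := Ideal.IsHomogeneous.exists_decompose_notMem (𝒜 := 𝒜) t ht
  have hspan : (Ideal.span {c}).IsHomogeneous 𝒜 :=
    Ideal.homogeneous_span 𝒜 _ (by simpa using ⟨i, hc⟩)
  -- Since `(c)` and `z ^ j` are homogeneous, `t` may be replaced by any of its homogeneous
  -- components, in particular one outside `P`.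
  have hmem := hspan (j • d + e) (show z ^ j * t ∈ Ideal.span {c} by
    rw [mul_comm, h]
    exact Ideal.mul_mem_right _ _ (Ideal.mem_span_singleton_self c))
  rw [DirectSum.coe_decompose_mul_add_of_left_mem 𝒜 (SetLike.pow_mem_graded j hz)] at hmem
  obtain ⟨a', ha'⟩ := Ideal.mem_span_singleton.mp hmem
  exact ⟨e, _, SetLike.coe_mem (DirectSum.decompose 𝒜 t e), he, j, a', by rw [mul_comm, ha']⟩

end Homogeneous

section Sections

variable {k A : Type*} [Field k] [CommRing A] [Algebra k A] {𝒜 : ℕ → Submodule k A}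
  [GradedAlgebra 𝒜] {K : Type*} [Field K] [Algebra A K] [Algebra k K] [IsScalarTower k A K]
  [IsDomain A] [FaithfulSMul A K]

/-- A fraction has a pole of finite order at a closed point, and a form vanishing there kills it
when raised to a high power: locally at `P`, the denominator of `x` divides a power of `z`. -/
theorem exists_pow_mul_mem_sectionsAt (hdim : ringKrullDim A = 2) {P : Ideal A}
    [hP : P.IsPrime] (hPh : P.IsHomogeneous 𝒜)
    (hPirr : ¬ (HomogeneousIdeal.irrelevant 𝒜).toIdeal ≤ P) {d n : ℕ} {z : A}
    (hzP : z ∈ P) (hz : z ∈ 𝒜 d) {x : K} (hx : x ∈ sectionsAt 𝒜 K (⊥ : Ideal A) n) :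
    ∃ j, algebraMap A K (z ^ j) * x ∈ sectionsAt 𝒜 K P (j * d + n) := by
  obtain ⟨i, b, hb, hb0, a, ha, hab⟩ := id hx
  obtain ⟨e, t, ht, htP, j, a', h⟩ :=
    exists_notMem_mul_pow_eq_mul hdim hPh hPirr (by simpa using hb0) hb hzP hz
  have hzj : z ^ j ∈ 𝒜 (j * d) := by simpa using SetLike.pow_mem_graded j hz
  have hx' := sectionsAt_mul_mem (algebraMap_mem_sectionsAt (K := K) (⊥ : Ideal A) hzj) hx
  have h1 : algebraMap A K t * (algebraMap A K (z ^ j) * x) = algebraMap A K (a' * a) := by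
    rw [← mul_assoc, ← map_mul, h, map_mul, map_mul, ← hab]
    ring
  have h2 := decompose_mul_mem_of_mul_mem hx' h1 e
  rw [DirectSum.decompose_of_mem_same 𝒜 ht] at h2
  exact ⟨j, e, t, ht, htP, _, SetLike.coe_mem _, h2⟩

end Sections

/-! ### Saturation of principal homogeneous ideals -/

section Saturation

variable {k A : Type*} [Field k] [CommRing A] [Algebra k A] {𝒜 : ℕ → Submodule k A}
  [GradedAlgebra 𝒜]

/-- Finitely many conditions, each of which holds for some homogeneous element outside the prime
ideal `P` and is preserved by multiplication, hold simultaneously. -/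
theorem exists_homogeneous_notMem_forall {ι : Type*} (s : Finset ι) (P : Ideal A) [hP : P.IsPrime]
    (C : ι → A → Prop) (hC : ∀ i ∈ s, ∃ d, ∃ u ∈ 𝒜 d, u ∉ P ∧ C i u)
    (hmul : ∀ i u v d, v ∈ 𝒜 d → C i u → C i (u * v)) :
    ∃ d, ∃ u ∈ 𝒜 d, u ∉ P ∧ ∀ i ∈ s, C i u := by
  classical
  induction s using Finset.induction_on with
  | empty => exact ⟨0, 1, SetLike.GradedOne.one_mem, P.one_notMem, by simp⟩
  | insert i s _ ih =>
    obtain ⟨d, u, hu, huP, h⟩ := ih fun j hj => hC j (Finset.mem_insert_of_mem hj)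
    obtain ⟨e, v, hv, hvP, h'⟩ := hC i (Finset.mem_insert_self i s)
    refine ⟨d + e, u * v, SetLike.GradedMul.mul_mem hu hv,
      fun h => (hP.mem_or_mem h).elim huP hvP, fun j hj => ?_⟩
    rcases Finset.mem_insert.mp hj with rfl | hj
    · rw [mul_comm]
      exact hmul _ _ _ _ hu h'
    · exact hmul _ _ _ _ hv (h j hj)

/-- If `G / c` is regular at every point of a projective curve, then it is saturated. -/
theorem exists_irrelevant_pow_mul_dvd [IsDomain A] [IsNoetherianRing A] {e m : ℕ} {c G : A}
    (hc0 : c ≠ 0) (hc : c ∈ 𝒜 e) (hG : G ∈ 𝒜 m)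
    (h : ∀ P : Ideal A, P.IsPrime → P.IsHomogeneous 𝒜 → P ≠ ⊥ →
      ¬ (HomogeneousIdeal.irrelevant 𝒜).toIdeal ≤ P → ∃ b, b ∉ P ∧ c ∣ b * G) :
    ∃ j, ∀ a ∈ (HomogeneousIdeal.irrelevant 𝒜).toIdeal ^ j, c ∣ a * G := by
  -- This is the colon ideal `(c) : G`. It is homogeneous and contains `c`, and by hypothesis every
  -- homogeneous prime above it contains the irrelevant ideal; so its radical does too.
  let J : Ideal A := Submodule.comap (LinearMap.toSpanSingleton A A G) (Ideal.span {c})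
  have hJ : ∀ a, a ∈ J ↔ c ∣ a * G := fun a => by
    change a • G ∈ Ideal.span {c} ↔ _
    rw [Ideal.mem_span_singleton, smul_eq_mul]
  have hspan : (Ideal.span {c}).IsHomogeneous 𝒜 :=
    Ideal.homogeneous_span 𝒜 _ (by simpa using ⟨e, hc⟩)
  have hJh : J.IsHomogeneous 𝒜 := by
    intro i a ha
    rw [hJ, ← Ideal.mem_span_singleton] at ha ⊢
    have := hspan (i + m) ha
    rwa [DirectSum.coe_decompose_mul_add_of_right_mem 𝒜 hG] at this
  have hrad : (HomogeneousIdeal.irrelevant 𝒜).toIdeal ≤ J.radical := by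
    rw [Ideal.IsHomogeneous.radical_eq hJh]
    refine le_sInf ?_
    rintro P ⟨hPh, hJP, hP⟩
    by_contra hirr
    have hP0 : P ≠ ⊥ := by
      rintro rfl
      exact hc0 (by simpa using hJP ((hJ c).mpr (dvd_mul_right c G)))
    obtain ⟨b, hbP, hb⟩ := h P hP hPh hP0 hirr
    exact hbP (hJP ((hJ b).mpr hb))
  obtain ⟨j, hj⟩ := Ideal.exists_pow_le_of_le_radical_of_fg hrad
    (IsNoetherian.noetherian _)
  exact ⟨j, fun a ha => (hJ a).mp (hj ha)⟩

/-- A principal homogeneous ideal of a noetherian graded ring generated in degree one agrees with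
its saturation in large degrees. -/
theorem eventually_dvd_of_irrelevant_pow_mul_dvd [IsNoetherianRing A]
    (hgen : ∀ i, ∀ a ∈ 𝒜 i, a ∈ (HomogeneousIdeal.irrelevant 𝒜).toIdeal ^ i) {e : ℕ} {c : A}
    (hc : c ∈ 𝒜 e) :
    ∀ᶠ n in Filter.atTop, ∀ g ∈ 𝒜 n,
      (∃ j, ∀ a ∈ (HomogeneousIdeal.irrelevant 𝒜).toIdeal ^ j, c ∣ a * g) → c ∣ g := by
  classical
  set N := (HomogeneousIdeal.irrelevant 𝒜).toIdeal with hN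
  have hspan : (Ideal.span {c}).IsHomogeneous 𝒜 :=
    Ideal.homogeneous_span 𝒜 _ (by simpa using ⟨e, hc⟩)
  let T : Ideal A :=
    { carrier := {g | ∃ j, ∀ a ∈ N ^ j, c ∣ a * g}
      zero_mem' := ⟨0, by simp⟩
      add_mem' := by
        rintro x y ⟨i, hi⟩ ⟨j, hj⟩
        refine ⟨i + j, fun a ha => ?_⟩
        rw [mul_add]
        exact dvd_add (hi a (Ideal.pow_le_pow_right (Nat.le_add_right i j) ha))
          (hj a (Ideal.pow_le_pow_right (Nat.le_add_left j i) ha))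
      smul_mem' := by
        rintro x y ⟨j, hj⟩
        refine ⟨j, fun a ha => ?_⟩
        rw [smul_eq_mul, mul_left_comm]
        exact Dvd.dvd.mul_left (hj a ha) x }
  obtain ⟨S, hS⟩ := IsNoetherian.noetherian T
  have hev : ∀ s ∈ S, ∀ᶠ n in Filter.atTop, ∀ a,
      GradedRing.proj 𝒜 n (a * s) ∈ Ideal.span {c} := by
    intro s hs
    obtain ⟨j, hj⟩ : s ∈ T := hS ▸ Submodule.subset_span hs
    obtain ⟨D, hD⟩ := (DirectSum.decompose 𝒜 s).support.bddAbove
    -- In degree `n > D + j`, a component of `a` of degree at least `j` lies in `N ^ j` and sends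
    -- `s` into `(c)`. A component of smaller degree would need a component of `s` in degree above
    -- `D`, where `s` has none.
    filter_upwards [Filter.eventually_ge_atTop (D + j + 1)] with n hn a
    rw [← DirectSum.sum_support_decompose 𝒜 a, Finset.sum_mul, map_sum]
    refine Ideal.sum_mem _ fun i _ => ?_
    rcases le_or_gt j i with hji | hij
    · refine hspan n (Ideal.mem_span_singleton.mpr (hj _ ?_))
      exact Ideal.pow_le_pow_right hji (hgen i _ (SetLike.coe_mem _))
    · rw [GradedRing.proj_apply,
        DirectSum.coe_decompose_mul_of_left_mem_of_le 𝒜 (SetLike.coe_mem _) (by omega)]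
      have : DirectSum.decompose 𝒜 s (n - i) = 0 := by
        by_contra h0
        have := hD (DFinsupp.mem_support_iff.mpr h0)
        omega
      rw [this]
      simp
  filter_upwards [(Filter.eventually_all_finset S).mpr hev] with n hn g hg hgT
  have key : ∀ x ∈ Submodule.span A (S : Set A), ∀ a,
      GradedRing.proj 𝒜 n (a * x) ∈ Ideal.span {c} := by
    intro x hx
    induction hx using Submodule.span_induction with
    | mem x hx => exact hn x hx
    | zero => simp
    | add x y _ _ hx hy =>
      intro a
      rw [mul_add, map_add]
      exact add_mem (hx a) (hy a)
    | smul b x _ hx =>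
      intro a
      rw [smul_eq_mul, ← mul_assoc]
      exact hx _
  have := key g (hS ▸ hgT) 1
  rwa [one_mul, GradedRing.proj_apply, DirectSum.decompose_of_mem_same 𝒜 hg,
    Ideal.mem_span_singleton] at this

end Saturation

/-! ### Normalization modulo the ring, seen inside a common field -/

section DeltaModule

variable (k O : Type*) [Field k] [CommRing O] [Algebra k O]

/-- The quotient `Ō / O` of the normalization `Ō` of `O`. -/
abbrev DeltaModule : Type _ :=
  integralClosure O (FractionRing O) ⧸
    LinearMap.range (Algebra.linearMap O (integralClosure O (FractionRing O)))

noncomputable instance deltaModuleModule : Module k (DeltaModule O) :=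
  Submodule.Quotient.module' _

theorem deltaInvariant_eq_zero [IsDomain O] [IsIntegrallyClosed O] : deltaInvariant k O = 0 := by
  have : Subsingleton (DeltaModule O) := by
    rw [Submodule.Quotient.subsingleton_iff, eq_top_iff]
    rintro ⟨x, hx⟩ -
    obtain ⟨y, hy⟩ := IsIntegrallyClosed.isIntegral_iff.mp hx
    exact ⟨y, Subtype.ext hy⟩
  have h : Module.rank k (DeltaModule O) = 0 := rank_subsingleton' k _
  rw [deltaInvariant, h, map_zero]

variable {O} (K : Type*) [IsDomain O] [Field K] [Algebra O K] [FaithfulSMul O K]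

/-- The embedding of the fraction field into a field extension. -/
noncomputable def fractionRingEmbedding : FractionRing O →ₐ[O] K :=
  IsFractionRing.liftAlgHom (g := Algebra.ofId O K) (FaithfulSMul.algebraMap_injective O K)

variable {K}

theorem mem_range_fractionRingEmbedding {x : K} :
    x ∈ (fractionRingEmbedding (O := O) K).range ↔
      ∃ a b : O, b ≠ 0 ∧ algebraMap O K b * x = algebraMap O K a := by
  have inj := FaithfulSMul.algebraMap_injective O K
  have hne : ∀ b : O, b ≠ 0 → algebraMap O K b ≠ 0 := fun b hb h =>
    hb (inj (h.trans (map_zero _).symm))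
  constructor
  · rintro ⟨z, rfl⟩
    obtain ⟨a, b, hb, rfl⟩ := IsFractionRing.div_surjective (A := O) z
    have hb0 := nonZeroDivisors.ne_zero hb
    refine ⟨a, b, hb0, ?_⟩
    change _ * fractionRingEmbedding (O := O) K _ = _
    rw [map_div₀, AlgHom.commutes, AlgHom.commutes, mul_div_cancel₀ _ (hne b hb0)]
  · rintro ⟨a, b, hb0, h⟩
    refine ⟨algebraMap O _ a / algebraMap O _ b, ?_⟩
    change fractionRingEmbedding (O := O) K _ = _
    rw [map_div₀, AlgHom.commutes, AlgHom.commutes, ← h, mul_div_cancel_left₀ _ (hne b hb0)]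

variable {k} [Algebra k K] [IsScalarTower k O K]

/-- Moves classes from the fraction field of each local ring to a common field `K`, where germs at
different points can be compared and added. -/
theorem exists_representatives {ι : Type*} [Fintype ι] (y : ι → DeltaModule O) :
    ∃ f : ι → K, (∀ i, IsIntegral O (f i)) ∧
      (∀ i, ∃ a b : O, b ≠ 0 ∧ algebraMap O K b * f i = algebraMap O K a) ∧
      ∀ c : ι → k, (∃ o : O, ∑ i, c i • f i = algebraMap O K o) → ∑ i, c i • y i = 0 := by
  choose z hz using fun i => Submodule.Quotient.mk_surjective _ (y i)
  let Λ := fractionRingEmbedding (O := O) K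
  refine ⟨fun i => Λ (z i), fun i => (z i).2.map Λ,
    fun i => mem_range_fractionRingEmbedding.mp ⟨z i, rfl⟩, fun c => ?_⟩
  rintro ⟨o, ho⟩
  have h1 : Λ (∑ i, c i • (z i : FractionRing O)) = Λ (algebraMap O _ o) := by
    rw [AlgHom.commutes, ← ho, map_sum]
    exact Finset.sum_congr rfl fun i _ => map_smul (Λ.restrictScalars k) (c i) _
  have h2 := Λ.toRingHom.injective h1
  have h3 : ∑ i, c i • z i = algebraMap O (integralClosure O (FractionRing O)) o := by
    apply Subtype.ext
    rw [AddSubmonoidClass.coe_finsetSum]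
    exact h2
  have h4 : ∑ i, c i • y i = Submodule.Quotient.mk (∑ i, c i • z i) := by
    rw [← Submodule.mkQ_apply, map_sum]
    exact Finset.sum_congr rfl fun i _ => by rw [← hz i]; rfl
  rw [h4, h3, Submodule.Quotient.mk_eq_zero]
  exact ⟨o, rfl⟩

/-- The opposite passage, from `K` back to `DeltaModule`. Linearity of the choice of preimages
follows from injectivity of the embedding of the fraction field. -/
theorem exists_linearMap_deltaModule {V : Type*} [AddCommGroup V] [Module k V] (g : V →ₗ[k] K)
    (hint : ∀ v, IsIntegral O (g v))
    (hfrac : ∀ v, ∃ a b : O, b ≠ 0 ∧ algebraMap O K b * g v = algebraMap O K a) :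
    ∃ ψ : V →ₗ[k] DeltaModule O, ∀ v, ψ v = 0 → ∃ o : O, g v = algebraMap O K o := by
  let Λ := fractionRingEmbedding (O := O) K
  have inj : Function.Injective Λ := Λ.toRingHom.injective
  choose z hz using fun v => mem_range_fractionRingEmbedding.mpr (hfrac v)
  have hz' : ∀ v, Λ (z v) = g v := hz
  have hzint : ∀ v, IsIntegral O (z v) := fun v => by
    rw [← isIntegral_algHom_iff Λ inj, hz']
    exact hint v
  refine ⟨{ toFun := fun v => Submodule.Quotient.mk ⟨z v, hzint v⟩
            map_add' := fun v w => ?_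
            map_smul' := fun c v => ?_ }, fun v hv => ?_⟩
  · rw [← Submodule.Quotient.mk_add]
    congr 1
    apply Subtype.ext
    apply inj
    change Λ (z (v + w)) = Λ (z v + z w)
    rw [map_add, hz', hz', hz', map_add]
  · rw [RingHom.id_apply, ← Submodule.Quotient.mk_smul]
    congr 1
    apply Subtype.ext
    apply inj
    change Λ (z (c • v)) = (Λ.restrictScalars k) (c • z v)
    rw [hz', map_smul, map_smul, ← hz']
    rfl
  · obtain ⟨o, ho⟩ := (Submodule.Quotient.mk_eq_zero _).mp hv
    refine ⟨o, ?_⟩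
    have h1 : algebraMap O (FractionRing O) o = z v := congrArg Subtype.val ho
    rw [← hz', ← h1, AlgHom.commutes]

end DeltaModule

/-! ### Dimension counts with values in `ℕ∞` -/

section Rank

universe u v

open Cardinal

theorem toENat_rank_pi {k : Type*} {ι : Type u} [Field k] [Fintype ι] (M : ι → Type v)
    [∀ i, AddCommGroup (M i)] [∀ i, Module k (M i)] :
    toENat (Module.rank k (∀ i, M i)) = ∑ i, toENat (Module.rank k (M i)) := by
  refine Fintype.induction_empty_option (P := fun ι _ => ∀ (M : ι → Type v)
    [∀ i, AddCommGroup (M i)] [∀ i, Module k (M i)],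
    toENat (Module.rank k (∀ i, M i)) = ∑ i, toENat (Module.rank k (M i))) ?_ ?_ ?_ ι M
  · intro α β _ e ih M _ _
    let : Fintype α := Fintype.ofEquiv β e.symm
    rw [← e.sum_comp]
    convert! ih fun a => M (e a) using 2
    exact (LinearEquiv.piCongrLeft k M e).symm.rank_eq
  · intro M _ _
    simp
  · intro α _ ih M _ _
    have := (LinearEquiv.piOptionEquivProd k (M := M)).lift_rank_eq
    rw [Fintype.sum_option, ← ih fun a => M (some a), ← toENat_lift, this, rank_prod]
    simp

theorem ENat.sum_le_tsum {ι : Type*} (f : ι → ℕ∞) (s : Finset ι) : ∑ i ∈ s, f i ≤ ∑' i, f i :=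
  (hasSum_of_isLUB (f := f) _ isLUB_iSup).summable.sum_le_tsum s fun _ _ => zero_le

theorem ENat.tsum_le_of_sum_le {ι : Type*} {f : ι → ℕ∞} {b : ℕ∞}
    (h : ∀ s : Finset ι, ∑ i ∈ s, f i ≤ b) : ∑' i, f i ≤ b :=
  (hasSum_of_isLUB (f := f) _ isLUB_iSup).summable.tsum_le_of_sum_le h

/-- A family of linear maps that is jointly injective bounds the dimension of the source. -/
theorem finrank_le_tsum_rank {k V ι : Type*} [Field k] [AddCommGroup V] [Module k V]
    [Module.Finite k V] (M : ι → Type*) [∀ i, AddCommGroup (M i)] [∀ i, Module k (M i)]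
    (ψ : ∀ i, V →ₗ[k] M i) (h : ∀ v, (∀ i, ψ i v = 0) → v = 0) :
    (Module.finrank k V : ℕ∞) ≤ ∑' i, toENat (Module.rank k (M i)) := by
  classical
  -- As `V` is finite-dimensional, some finite set of indices has minimal common kernel. Adding a
  -- further index cannot shrink it, so it lies in every kernel and vanishes; finitely many maps are
  -- already jointly injective.
  obtain ⟨_, ⟨s, rfl⟩, hs⟩ := IsArtinian.set_has_minimal
    (Set.range fun s : Finset ι => s.inf fun i => LinearMap.ker (ψ i)) (Set.range_nonempty _)
  have hinj : Function.Injective (LinearMap.pi fun i : s => ψ i) := by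
    rw [← LinearMap.ker_eq_bot, LinearMap.ker_eq_bot']
    intro v hv
    have hvs : v ∈ s.inf fun i => LinearMap.ker (ψ i) := by
      simp only [Submodule.mem_finsetInf, LinearMap.mem_ker]
      exact fun i hi => congrFun hv ⟨i, hi⟩
    refine h v fun i => ?_
    have hle : ((insert i s).inf fun i => LinearMap.ker (ψ i)) ≤
        s.inf fun i => LinearMap.ker (ψ i) := Finset.inf_mono (Finset.subset_insert i s)
    have heq := eq_of_le_of_not_lt hle (hs _ ⟨insert i s, rfl⟩)
    rw [← heq, Finset.inf_insert] at hvs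
    exact hvs.1
  have h1 := OrderHomClass.mono toENat (LinearMap.lift_rank_le_of_injective _ hinj)
  rw [toENat_lift, toENat_lift, toENat_rank_pi fun i : s => M i, ← Module.finrank_eq_rank k V,
    toENat_nat] at h1
  refine h1.trans (le_trans (le_of_eq ?_) (ENat.sum_le_tsum _ s))
  exact Finset.sum_coe_sort s fun i => toENat (Module.rank k (M i))

/-- If a finite product has dimension at least `m`, it contains `m` linearly independent
elements. -/
theorem exists_linearIndependent_of_le_sum {k ι : Type*} [Field k] (s : Finset ι)
    (M : ι → Type*) [∀ i, AddCommGroup (M i)] [∀ i, Module k (M i)] (m : ℕ)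
    (h : (m : ℕ∞) ≤ ∑ i ∈ s, toENat (Module.rank k (M i))) :
    ∃ y : Fin m → ∀ i : s, M i, LinearIndependent k y := by
  rw [← Finset.sum_coe_sort, ← toENat_rank_pi fun i : s => M i, natCast_le_toENat] at h
  exact Module.le_rank_iff.mp h

end Rank

/-- Elements of the normalizations of finitely many rings, with images in a common field, that are
jointly linearly independent modulo these rings. -/
theorem exists_jointly_independent_representatives {k ι : Type*} [Field k] (O : ι → Type*)
    [∀ i, CommRing (O i)] [∀ i, IsDomain (O i)] [∀ i, Algebra k (O i)] (K : Type*) [Field K]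
    [Algebra k K] [∀ i, Algebra (O i) K] [∀ i, FaithfulSMul (O i) K]
    [∀ i, IsScalarTower k (O i) K] (s : Finset ι) (m : ℕ)
    (h : (m : ℕ∞) ≤ ∑ i ∈ s, deltaInvariant k (O i)) :
    ∃ f : s → Fin m → K, (∀ (i : s) j, IsIntegral (O i) (f i j)) ∧
      (∀ (i : s) j, ∃ a b : O i, b ≠ 0 ∧ algebraMap (O i) K b * f i j = algebraMap (O i) K a) ∧
      ∀ c : Fin m → k, (∀ i : s, ∃ o : O i, ∑ j, c j • f i j = algebraMap (O i) K o) → c = 0 := by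
  obtain ⟨y, hy⟩ := exists_linearIndependent_of_le_sum s (fun i => DeltaModule (O i)) m h
  choose f hfint hffrac hf using fun i : s =>
    exists_representatives (k := k) (K := K) fun j => y j i
  refine ⟨f, hfint, hffrac, fun c hc => ?_⟩
  have hy0 : ∑ j, c j • y j = 0 := by
    funext i
    rw [Finset.sum_apply]
    exact hf i c (hc i)
  exact funext (Fintype.linearIndependent_iff.mp hy c hy0)

/-! ### Integral equations written with coefficient sequences -/

section IntegralEquation

variable {R S : Type*} [CommRing R] [CommRing S] [Algebra R S]

theorem isIntegral_of_pow_add_sum_eq_zero {y : S} {d : ℕ} (c : ℕ → R)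
    (h : y ^ d + ∑ j ∈ Finset.range d, algebraMap R S (c j) * y ^ j = 0) : IsIntegral R y := by
  refine ⟨Polynomial.X ^ d + ∑ j ∈ Finset.range d, Polynomial.C (c j) * Polynomial.X ^ j,
    Polynomial.monic_X_pow_add ?_, ?_⟩
  · refine (Polynomial.degree_sum_le _ _).trans_lt
      ((Finset.sup_lt_iff (WithBot.bot_lt_coe d)).mpr fun j hj => ?_)
    exact (Polynomial.degree_C_mul_X_pow_le j _).trans_lt
      (WithBot.coe_lt_coe.mpr (Finset.mem_range.mp hj))
  · rw [← h]
    simp [Polynomial.eval₂_add, Polynomial.eval₂_finsetSum]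

theorem IsIntegral.exists_pow_add_sum_eq_zero {y : S} (h : IsIntegral R y) :
    ∃ (d : ℕ) (c : ℕ → R), y ^ d + ∑ j ∈ Finset.range d, algebraMap R S (c j) * y ^ j = 0 := by
  obtain ⟨p, hp, hy⟩ := h
  refine ⟨p.natDegree, p.coeff, ?_⟩
  rw [hp.as_sum] at hy
  simpa [Polynomial.eval₂_add, Polynomial.eval₂_finsetSum] using hy

end IntegralEquation

/-! ### Local rings of the curve and integrality over them -/

section LocalRing

variable {k A : Type*} [Field k] [CommRing A] [IsDomain A] [Algebra k A] {𝒜 : ℕ → Submodule k A}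
  [GradedAlgebra 𝒜] {P : Ideal A} [hP : P.IsPrime]

open HomogeneousLocalization

theorem isUnit_algebraMap_fractionRing (b : P.primeCompl) :
    IsUnit (algebraMap A (FractionRing A) b) := by
  rw [isUnit_iff_ne_zero, Ne, IsFractionRing.to_map_eq_zero_iff]
  rintro h
  exact b.2 (h ▸ P.zero_mem)

/-- A homogeneous localization of a domain embeds into its fraction field. -/
noncomputable instance homogeneousLocalizationToFractionRing :
    Algebra (HomogeneousLocalization.AtPrime 𝒜 P) (FractionRing A) :=
  ((IsLocalization.lift (M := P.primeCompl) (S := Localization P.primeCompl)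
    (isUnit_algebraMap_fractionRing (P := P))).comp
    (algebraMap (HomogeneousLocalization.AtPrime 𝒜 P) (Localization P.primeCompl))).toAlgebra

theorem den_mul_algebraMap_mk (c : NumDenSameDeg 𝒜 P.primeCompl) :
    algebraMap A (FractionRing A) c.den *
      algebraMap (HomogeneousLocalization.AtPrime 𝒜 P) (FractionRing A)
        (HomogeneousLocalization.mk c) = algebraMap A (FractionRing A) c.num := by
  change _ * IsLocalization.lift (isUnit_algebraMap_fractionRing (P := P))
    (HomogeneousLocalization.mk c).val = _
  rw [HomogeneousLocalization.val_mk, Localization.mk_eq_mk']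
  exact ((IsLocalization.lift_mk'_spec (M := P.primeCompl)
    (isUnit_algebraMap_fractionRing (P := P)) _ _ _).mp rfl).symm

theorem exists_algebraMap_eq_iff {x : FractionRing A} :
    (∃ o, algebraMap (HomogeneousLocalization.AtPrime 𝒜 P) (FractionRing A) o = x) ↔
      x ∈ sectionsAt 𝒜 (FractionRing A) P 0 := by
  constructor
  · rintro ⟨o, rfl⟩
    obtain ⟨c, rfl⟩ := HomogeneousLocalization.mk_surjective o
    exact ⟨c.deg, c.den, c.den.2, c.den_mem, c.num, c.num.2, den_mul_algebraMap_mk c⟩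
  · rintro ⟨i, b, hb, hbP, a, ha, h⟩
    refine ⟨HomogeneousLocalization.mk ⟨i, ⟨a, ha⟩, ⟨b, hb⟩, hbP⟩, ?_⟩
    have hb0 : algebraMap A (FractionRing A) b ≠ 0 :=
      (isUnit_algebraMap_fractionRing (P := P) ⟨b, hbP⟩).ne_zero
    apply mul_left_cancel₀ hb0
    rw [h]
    exact den_mul_algebraMap_mk (⟨i, ⟨a, ha⟩, ⟨b, hb⟩, hbP⟩ : NumDenSameDeg 𝒜 P.primeCompl)

instance : FaithfulSMul (HomogeneousLocalization.AtPrime 𝒜 P) (FractionRing A) := by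
  rw [faithfulSMul_iff_algebraMap_injective]
  refine Function.Injective.comp (g := IsLocalization.lift (M := P.primeCompl)
    (S := Localization P.primeCompl) (isUnit_algebraMap_fractionRing (P := P))) ?_
    (HomogeneousLocalization.val_injective P.primeCompl)
  refine (IsLocalization.lift_injective_iff _).mpr fun x y => ?_
  rw [(IsLocalization.injective (Localization P.primeCompl) P.primeCompl_le_nonZeroDivisors).eq_iff,
    (IsFractionRing.injective A (FractionRing A)).eq_iff]

instance : IsDomain (HomogeneousLocalization.AtPrime 𝒜 P) :=
  (FaithfulSMul.algebraMap_injective (HomogeneousLocalization.AtPrime 𝒜 P)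
    (FractionRing A)).isDomain (algebraMap _ _)

instance : IsScalarTower k (HomogeneousLocalization.AtPrime 𝒜 P) (FractionRing A) := by
  refine IsScalarTower.of_algebraMap_eq
    (R := k) (S := HomogeneousLocalization.AtPrime 𝒜 P) (A := FractionRing A) fun c => ?_
  have := den_mul_algebraMap_mk (𝒜 := 𝒜) (P := P)
    (⟨0, algebraMap k (𝒜 0) c, 1, P.primeCompl.one_mem⟩ : NumDenSameDeg 𝒜 P.primeCompl)
  rw [IsScalarTower.algebraMap_apply k A (FractionRing A)]
  change _ = algebraMap _ (FractionRing A) (HomogeneousLocalization.mk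
    (⟨0, algebraMap k (𝒜 0) c, 1, P.primeCompl.one_mem⟩ : NumDenSameDeg 𝒜 P.primeCompl))
  simpa using this.symm

theorem mem_sectionsAt_bot_of_exists_fraction {x : FractionRing A}
    (h : ∃ a b : HomogeneousLocalization.AtPrime 𝒜 P, b ≠ 0 ∧
      algebraMap _ (FractionRing A) b * x = algebraMap _ (FractionRing A) a) :
    x ∈ sectionsAt 𝒜 (FractionRing A) (⊥ : Ideal A) 0 := by
  obtain ⟨o, o', ho', h⟩ := h
  have ho := sectionsAt_le_of_le bot_le 0 (exists_algebraMap_eq_iff.mp ⟨o, rfl⟩)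
  obtain ⟨i, b, hb, hbP, a, ha, hab⟩ := exists_algebraMap_eq_iff.mp ⟨o', rfl⟩
  have ha0 : a ≠ 0 := by
    rintro rfl
    rw [map_zero, mul_eq_zero,
      or_iff_right (isUnit_algebraMap_fractionRing (P := P) ⟨b, hbP⟩).ne_zero] at hab
    exact ho' (FaithfulSMul.algebraMap_injective _ (FractionRing A) (hab.trans (map_zero _).symm))
  refine mem_sectionsAt_of_mul_mem (l := a) ha (by simpa using ha0) ?_
  rw [← hab, mul_assoc, h]
  exact sectionsAt_mul_mem (algebraMap_mem_sectionsAt _ hb) ho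

theorem exists_fraction_of_mem_sectionsAt_bot {l : A} (hl : l ∈ 𝒜 1) (hlP : l ∉ P)
    {x : FractionRing A} (hx : x ∈ sectionsAt 𝒜 (FractionRing A) (⊥ : Ideal A) 0) :
    ∃ a b : HomogeneousLocalization.AtPrime 𝒜 P, b ≠ 0 ∧
      algebraMap _ (FractionRing A) b * x = algebraMap _ (FractionRing A) a := by
  obtain ⟨i, b, hb, hb0, a, ha, hab⟩ := hx
  have hl0 : algebraMap A (FractionRing A) l ≠ 0 :=
    (isUnit_algebraMap_fractionRing (P := P) ⟨l, hlP⟩).ne_zero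
  have hli : l ^ i ∈ 𝒜 i := by simpa using SetLike.pow_mem_graded i hl
  have key : ∀ c ∈ 𝒜 (i + 0), ∃ o : HomogeneousLocalization.AtPrime 𝒜 P,
      algebraMap _ (FractionRing A) o =
        algebraMap A (FractionRing A) c / algebraMap A (FractionRing A) l ^ i := fun c hc =>
    exists_algebraMap_eq_iff.mpr ⟨i, l ^ i, hli, fun h => hlP (hP.mem_of_pow_mem i h), c, hc, by
      rw [map_pow, mul_div_cancel₀ _ (pow_ne_zero i hl0)]⟩
  obtain ⟨o, ho⟩ := key a ha
  obtain ⟨o', ho'⟩ := key b hb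
  refine ⟨o, o', ?_, ?_⟩
  · rintro rfl
    rw [map_zero, eq_comm, div_eq_zero_iff, or_iff_left (pow_ne_zero i hl0),
      IsFractionRing.to_map_eq_zero_iff] at ho'
    exact hb0 (by simpa using ho')
  · rw [ho, ho', ← hab]
    ring

/-- An element that is integral over the local ring at `P` becomes integral over the coordinate
ring after multiplication by a homogeneous element outside `P`. -/
theorem exists_isIntegral_mul {y : FractionRing A}
    (hy : IsIntegral (HomogeneousLocalization.AtPrime 𝒜 P) y) :
    ∃ d, ∃ u ∈ 𝒜 d, u ∉ P ∧ IsIntegral A (algebraMap A (FractionRing A) u * y) := by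
  obtain ⟨d, c, h⟩ := hy.exists_pow_add_sum_eq_zero
  obtain ⟨e, u, hu, huP, hC⟩ := exists_homogeneous_notMem_forall (𝒜 := 𝒜) (Finset.range d) P
    (fun j u => ∃ a, algebraMap A (FractionRing A) u * algebraMap _ (FractionRing A) (c j) =
      algebraMap A (FractionRing A) a) (fun j _ => by
        obtain ⟨i, b, hb, hbP, a, _, h⟩ := exists_algebraMap_eq_iff.mp ⟨c j, rfl⟩
        exact ⟨i, b, hb, hbP, a, h⟩) (by
        rintro j u v _ _ ⟨a, ha⟩
        exact ⟨v * a, by rw [map_mul, map_mul, ← ha]; ring⟩)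
  choose! a ha using hC
  -- The equation for `y` is multiplied by `u ^ d`. In the `j`-th coefficient one factor `u` clears
  -- the denominator of `c j`, leaving `u ^ (d - 1 - j)`.
  refine ⟨e, u, hu, huP, isIntegral_of_pow_add_sum_eq_zero (d := d)
    (fun j => a j * u ^ (d - 1 - j)) ?_⟩
  have : algebraMap A (FractionRing A) u ^ d * (y ^ d +
    ∑ j ∈ Finset.range d, algebraMap _ (FractionRing A) (c j) * y ^ j) = 0 := by rw [h, mul_zero]
  rw [← this, mul_add, mul_pow, Finset.mul_sum]
  congr 1
  refine Finset.sum_congr rfl fun j hj => ?_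
  have hj' := Finset.mem_range.mp hj
  have hd : d = 1 + (d - 1 - j) + j := by omega
  conv_rhs => rw [hd]
  rw [map_mul, ← ha j hj, map_pow, mul_pow, pow_add, pow_add]
  ring

/-- If `l * y` is integral over the coordinate ring, `l` being homogeneous and outside `P`, and
`y` is a homogeneous fraction of degree zero, then `y` is integral over the local ring at `P`. -/
theorem isIntegral_localRing_of_mul {n : ℕ} {l : A} (hl : l ∈ 𝒜 n) (hlP : l ∉ P)
    {y : FractionRing A} (hy : y ∈ sectionsAt 𝒜 (FractionRing A) (⊥ : Ideal A) 0)
    (h : IsIntegral A (algebraMap A (FractionRing A) l * y)) :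
    IsIntegral (HomogeneousLocalization.AtPrime 𝒜 P) y := by
  obtain ⟨d, c, h⟩ := h.exists_pow_add_sum_eq_zero
  have hl0 : algebraMap A (FractionRing A) l ≠ 0 :=
    (isUnit_algebraMap_fractionRing (P := P) ⟨l, hlP⟩).ne_zero
  obtain ⟨i, b, hb, hb0, a, ha, hab⟩ := hy
  have hb0' : algebraMap A (FractionRing A) b ≠ 0 := by
    rw [Ne, IsFractionRing.to_map_eq_zero_iff]
    simpa using hb0
  -- the homogeneous component of the equation in the appropriate degree
  have h1 : (l * a) ^ d + ∑ j ∈ Finset.range d, (b ^ (d - j) * (l * a) ^ j) * c j = 0 := by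
    apply IsFractionRing.injective A (FractionRing A)
    have := congrArg (fun t => algebraMap A (FractionRing A) b ^ d * t) h
    simp only [mul_zero, mul_add, Finset.mul_sum] at this
    rw [map_zero, ← this, map_add, map_sum]
    congr 1
    · rw [map_pow, map_mul, ← hab]
      ring
    · refine Finset.sum_congr rfl fun j hj => ?_
      have hd : d = (d - j) + j := by have := Finset.mem_range.mp hj; omega
      conv_rhs => rw [hd]
      rw [map_mul, map_mul, map_pow, map_pow, map_mul, ← hab, pow_add]
      ring
  have hla : l * a ∈ 𝒜 (n + i) := SetLike.GradedMul.mul_mem hl ha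
  -- As `l * y` has degree `n`, only this component of the coefficient contributes in the degree of
  -- the leading term. Dividing it by `l ^ (d - j)` gives a degree-zero coefficient regular at `P`.
  let q : ℕ → A := fun j => DirectSum.decompose 𝒜 (c j) ((d - j) * n)
  have h2 : (l * a) ^ d + ∑ j ∈ Finset.range d, (b ^ (d - j) * (l * a) ^ j) * q j = 0 := by
    have h2 := congrArg (GradedRing.proj 𝒜 (d * (n + i))) h1
    rw [map_add, map_sum, map_zero] at h2
    rw [← h2]
    congr 1
    · rw [GradedRing.proj_apply, DirectSum.decompose_of_mem_same 𝒜]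
      simpa using SetLike.pow_mem_graded d hla
    · refine Finset.sum_congr rfl fun j hj => ?_
      have hd : d = (d - j) + j := by have := Finset.mem_range.mp hj; omega
      have hmem : b ^ (d - j) * (l * a) ^ j ∈ 𝒜 ((d - j) * i + j * (n + i)) := by
        simpa using SetLike.GradedMul.mul_mem (SetLike.pow_mem_graded (d - j) hb)
          (SetLike.pow_mem_graded j hla)
      rw [GradedRing.proj_apply, show d * (n + i) =
        (d - j) * i + j * (n + i) + (d - j) * n by conv_lhs => rw [hd]
                                                   ring,
        DirectSum.coe_decompose_mul_add_of_left_mem 𝒜 hmem]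
  have hq : ∀ j, ∃ o, algebraMap (HomogeneousLocalization.AtPrime 𝒜 P) (FractionRing A) o =
      algebraMap A (FractionRing A) (q j) / algebraMap A (FractionRing A) l ^ (d - j) := by
    intro j
    refine exists_algebraMap_eq_iff.mpr ⟨(d - j) * n, l ^ (d - j),
      by simpa using SetLike.pow_mem_graded (d - j) hl, fun h => hlP (hP.mem_of_pow_mem _ h), q j,
      SetLike.coe_mem _, ?_⟩
    rw [map_pow, mul_div_cancel₀ _ (pow_ne_zero _ hl0)]
  choose o ho using hq
  refine isIntegral_of_pow_add_sum_eq_zero (d := d) o ?_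
  apply mul_left_cancel₀ (mul_ne_zero (pow_ne_zero d hb0') (pow_ne_zero d hl0))
  rw [mul_zero, ← map_zero (algebraMap A (FractionRing A)), ← h2, map_add, map_sum, mul_add,
    Finset.mul_sum]
  congr 1
  · rw [map_pow, map_mul, ← hab]
    ring
  · refine Finset.sum_congr rfl fun j hj => ?_
    have hd : d = (d - j) + j := by have := Finset.mem_range.mp hj; omega
    rw [map_mul, map_mul, map_pow, map_pow, map_mul, ← hab, ho]
    conv_lhs => rw [hd]
    rw [pow_add, pow_add]
    simp only [Nat.add_sub_cancel]
    have := pow_ne_zero (d - j) hl0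
    field_simp
    ring

/-- Every nonzero prime of the local ring is maximal, so its dimension is at most one. Regularity
bounds the cotangent space by the same number, and a noetherian local domain with cotangent
dimension at most one is integrally closed. -/
theorem isIntegrallyClosed_of_isRegularLocalRing (hdim : ringKrullDim A = 2)
    (hPh : P.IsHomogeneous 𝒜) (hPirr : ¬ (HomogeneousIdeal.irrelevant 𝒜).toIdeal ≤ P)
    (hreg : IsRegularLocalRing (HomogeneousLocalization.AtPrime 𝒜 P)) :
    IsIntegrallyClosed (HomogeneousLocalization.AtPrime 𝒜 P) := by
  have hmax : ∀ I : Ideal (HomogeneousLocalization.AtPrime 𝒜 P), I ≠ ⊥ → I.IsPrime →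
      I.IsMaximal := by
    intro I hI0 hI
    suffices h : IsLocalRing.maximalIdeal (HomogeneousLocalization.AtPrime 𝒜 P) ≤ I by
      rw [← (IsLocalRing.maximalIdeal.isMaximal _).eq_of_le hI.ne_top h]
      exact IsLocalRing.maximalIdeal.isMaximal _
    obtain ⟨o, hoI, ho0⟩ := Submodule.exists_mem_ne_zero_of_ne_bot hI0
    have ho0' : algebraMap _ (FractionRing A) o ≠ 0 := fun h => ho0
      (FaithfulSMul.algebraMap_injective _ (FractionRing A) (h.trans (map_zero _).symm))
    -- The inverse of `o` has a pole of finite order at `P`, so `x ^ j * o⁻¹` becomes regular for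
    -- `x` in the maximal ideal. Hence a power of `x` is a multiple of `o` and lies in `I`.
    have hinv : (algebraMap _ (FractionRing A) o)⁻¹ ∈
        sectionsAt 𝒜 (FractionRing A) (⊥ : Ideal A) 0 :=
      mem_sectionsAt_bot_of_exists_fraction (P := P) ⟨1, o, ho0, by
        rw [mul_inv_cancel₀ ho0', map_one]⟩
    intro x hx
    obtain ⟨⟨d, ⟨z, hz⟩, ⟨b, hb⟩, hbP⟩, rfl⟩ := HomogeneousLocalization.mk_surjective x
    have hbz := den_mul_algebraMap_mk
      (⟨d, ⟨z, hz⟩, ⟨b, hb⟩, hbP⟩ : NumDenSameDeg 𝒜 P.primeCompl)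
    set x := HomogeneousLocalization.mk
      (⟨d, ⟨z, hz⟩, ⟨b, hb⟩, hbP⟩ : NumDenSameDeg 𝒜 P.primeCompl)
    simp only at hbz
    have hzP : z ∈ P := by
      by_contra hzP
      refine (IsLocalRing.mem_maximalIdeal _).mp hx (IsUnit.of_mul_eq_one (HomogeneousLocalization.mk
        (⟨d, ⟨b, hb⟩, ⟨z, hz⟩, hzP⟩ : NumDenSameDeg 𝒜 P.primeCompl)) ?_)
      have hzb := den_mul_algebraMap_mk
        (⟨d, ⟨b, hb⟩, ⟨z, hz⟩, hzP⟩ : NumDenSameDeg 𝒜 P.primeCompl)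
      apply FaithfulSMul.algebraMap_injective _ (FractionRing A)
      apply mul_left_cancel₀ (isUnit_algebraMap_fractionRing (P := P) ⟨z, hzP⟩).ne_zero
      rw [map_mul, mul_left_comm, hzb, mul_comm, hbz, map_one, mul_one]
    obtain ⟨j, hj⟩ := exists_pow_mul_mem_sectionsAt hdim hPh hPirr hzP hz hinv
    have hbj : b ^ j ∈ 𝒜 (j * d) := by simpa using SetLike.pow_mem_graded j hb
    rw [map_pow, ← hbz, mul_pow, ← map_pow, mul_assoc] at hj
    obtain ⟨o', ho'⟩ := exists_algebraMap_eq_iff.mpr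
      (mem_sectionsAt_of_mul_mem hbj (fun h => hbP (hP.mem_of_pow_mem j h)) hj)
    refine hI.mem_of_pow_mem j ?_
    have : x ^ j = o' * o := by
      apply FaithfulSMul.algebraMap_injective _ (FractionRing A)
      rw [map_mul, ho', map_pow, mul_assoc, inv_mul_cancel₀ ho0', mul_one]
    rw [this]
    exact I.mul_mem_left o' hoI
  have hdim1 : ringKrullDim (HomogeneousLocalization.AtPrime 𝒜 P) ≤ 1 := by
    have : (⊥ : Ideal (HomogeneousLocalization.AtPrime 𝒜 P)).IsPrime := Ideal.isPrime_bot
    exact Ring.krullDimLE_iff.mp (Ring.krullDimLE_one_iff_of_isPrime_bot.mpr hmax)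
  rw [← (IsRegularLocalRing.iff_finrank_cotangentSpace _).mp hreg] at hdim1
  have htfae := tfae_of_isNoetherianRing_of_isLocalRing_of_isDomain
    (HomogeneousLocalization.AtPrime 𝒜 P)
  have h5 : Module.finrank (IsLocalRing.ResidueField (HomogeneousLocalization.AtPrime 𝒜 P))
      (IsLocalRing.CotangentSpace (HomogeneousLocalization.AtPrime 𝒜 P)) ≤ 1 := by
    exact_mod_cast hdim1
  have h3 := (htfae.out 5 3).mp h5
  exact h3.1

end LocalRing

/-! ### Closed points and generation in degree one -/

namespace ProjectiveCurve

section General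

variable {k : Type*} [Field k] {r : ℕ} (Γ : ProjectiveCurve k r)

instance : IsDomain Γ.coordinateRing :=
  have := Γ.isPrime
  Ideal.Quotient.isDomain Γ.ideal

theorem mem_grading_iff {n : ℕ} {a : Γ.coordinateRing} :
    a ∈ Γ.grading n ↔ ∃ f : MvPolynomial (Fin (r + 1)) k,
      f.IsHomogeneous n ∧ Ideal.Quotient.mk Γ.ideal f = a := Iff.rfl

theorem mem_map_idealOfVars_pow {n : ℕ} {a : Γ.coordinateRing} (ha : a ∈ Γ.grading n) :
    a ∈ (MvPolynomial.idealOfVars (Fin (r + 1)) k).map (Ideal.Quotient.mk Γ.ideal) ^ n := by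
  obtain ⟨f, hf, rfl⟩ := Γ.mem_grading_iff.mp ha
  rw [← Ideal.map_pow]
  refine Ideal.mem_map_of_mem _ ((MvPolynomial.mem_pow_idealOfVars_iff n f).mpr fun x hx => ?_)
  have := hf (MvPolynomial.mem_support_iff.mp hx)
  exact (this.symm.trans (DFunLike.congr_fun Finsupp.degree_eq_weight_one.symm x)).le

theorem mk_X_mem_grading (i : Fin (r + 1)) :
    Ideal.Quotient.mk Γ.ideal (MvPolynomial.X i) ∈ Γ.grading 1 :=
  ⟨_, MvPolynomial.isHomogeneous_X k i, rfl⟩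

theorem mem_irrelevant_pow {n : ℕ} {a : Γ.coordinateRing} (ha : a ∈ Γ.grading n) :
    a ∈ (HomogeneousIdeal.irrelevant Γ.grading).toIdeal ^ n := by
  refine Ideal.pow_right_mono ?_ n (Γ.mem_map_idealOfVars_pow ha)
  rw [MvPolynomial.idealOfVars, Ideal.map_span, Ideal.span_le]
  rintro _ ⟨_, ⟨i, rfl⟩, rfl⟩
  exact DirectSum.decompose_of_mem_ne Γ.grading (Γ.mk_X_mem_grading i) one_ne_zero

theorem exists_linear_notMem {P : Ideal Γ.coordinateRing} [P.IsPrime]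
    (hP : ¬ (HomogeneousIdeal.irrelevant Γ.grading).toIdeal ≤ P) : ∃ l ∈ Γ.grading 1, l ∉ P := by
  classical
  by_contra! h
  refine hP fun a ha => ?_
  rw [← DirectSum.sum_support_decompose Γ.grading a]
  refine Ideal.sum_mem _ fun i _ => ?_
  rcases Nat.eq_zero_or_pos i with rfl | hi
  · have h0 : (DirectSum.decompose Γ.grading a 0 : Γ.coordinateRing) = 0 := ha
    rw [h0]
    exact P.zero_mem
  · have h1 := Γ.mem_map_idealOfVars_pow (SetLike.coe_mem (DirectSum.decompose Γ.grading a i))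
    refine (Ideal.pow_le_self hi.ne').trans ?_ h1
    rw [MvPolynomial.idealOfVars, Ideal.map_span, Ideal.span_le]
    rintro _ ⟨_, ⟨i, rfl⟩, rfl⟩
    exact h _ (Γ.mk_X_mem_grading i)

variable {Γ}

/-- The homogeneous prime ideal of a closed point. -/
noncomputable abbrev Point.ideal (P : Γ.Point) : Ideal Γ.coordinateRing := P.1.asHomogeneousIdeal.toIdeal

theorem Point.isHomogeneous_ideal (P : Γ.Point) : P.ideal.IsHomogeneous Γ.grading :=
  P.1.asHomogeneousIdeal.isHomogeneous

theorem Point.not_irrelevant_le (P : Γ.Point) :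
    ¬ (HomogeneousIdeal.irrelevant Γ.grading).toIdeal ≤ P.ideal := P.1.not_irrelevant_le

/-- An inclusion would place `Q` in the closure of the closed point `P`. -/
theorem Point.not_le_of_ne {P Q : Γ.Point} (h : P ≠ Q) : ¬ P.ideal ≤ Q.ideal := by
  intro hle
  have h1 : Q.1 ∈ closure {P.1} := (ProjectiveSpectrum.le_iff_mem_closure Γ.grading P.1 Q.1).mp hle
  rw [P.2.closure_eq] at h1
  exact h (Subtype.ext h1).symm

/-- A nonzero homogeneous prime ideal that does not contain the irrelevant ideal is the ideal of a
closed point. -/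
theorem exists_point_ideal_eq {P : Ideal Γ.coordinateRing} (hP : P.IsPrime)
    (hPh : P.IsHomogeneous Γ.grading) (hP0 : P ≠ ⊥)
    (hPirr : ¬ (HomogeneousIdeal.irrelevant Γ.grading).toIdeal ≤ P) :
    ∃ Q : Γ.Point, Q.ideal = P := by
  let Q : ProjectiveSpectrum Γ.grading := ⟨⟨P, hPh⟩, hP, hPirr⟩
  refine ⟨⟨Q, ?_⟩, rfl⟩
  rw [← closure_subset_iff_isClosed]
  intro R hR
  have hle : P ≤ R.asHomogeneousIdeal.toIdeal :=
    (ProjectiveSpectrum.le_iff_mem_closure Γ.grading Q R).mpr hR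
  have := eq_of_le_of_ringKrullDim_eq_two Γ.dim_eq R.asHomogeneousIdeal.isHomogeneous
    R.not_irrelevant_le hP0 hle
  exact ProjectiveSpectrum.ext (HomogeneousIdeal.toIdeal_injective this.symm)

theorem deltaAt_eq_zero_of_notMem_singularLocus {P : Γ.Point} (hP : P ∉ Γ.singularLocus) :
    Γ.deltaAt P = 0 := by
  have := isIntegrallyClosed_of_isRegularLocalRing Γ.dim_eq P.isHomogeneous_ideal
    P.not_irrelevant_le (not_not.mp hP)
  exact deltaInvariant_eq_zero k (Γ.localRing P)

end General

/-! ### Gluing germs into homogeneous integral fractions -/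

section Gluing

variable {k : Type*} [Field k] {r : ℕ} {Γ : ProjectiveCurve k r}

local notation "𝕂" => FractionRing Γ.coordinateRing

/-- One factor of `u` makes `f` integral over the coordinate ring; another, vanishing at `Q` but not
at `P`, removes the pole at `Q`. The degree is existential in the last clause so that the condition
can be stated for `u` alone and persists under multiplication. -/
theorem exists_homogeneous_mul_mem_sectionsAt {P : Γ.Point} {f : 𝕂}
    (hf : IsIntegral (Γ.localRing P) f) (hf0 : f ∈ sectionsAt Γ.grading 𝕂 ⊥ 0) (Q : Γ.Point) :
    ∃ d, ∃ u ∈ Γ.grading d, u ∉ P.ideal ∧ IsIntegral Γ.coordinateRing (algebraMap _ 𝕂 u * f) ∧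
      (Q ≠ P → ∃ e, u ∈ Γ.grading e ∧ algebraMap _ 𝕂 u * f ∈ sectionsAt Γ.grading 𝕂 Q.ideal e) := by
  obtain ⟨d, u, hu, huP, hint⟩ := exists_isIntegral_mul hf
  by_cases hQP : Q = P
  · exact ⟨d, u, hu, huP, hint, fun h => absurd hQP h⟩
  obtain ⟨i, z, hz, hzQ, hzP⟩ := HomogeneousIdeal.exists_mem_notMem_of_not_le
    Q.isHomogeneous_ideal (Point.not_le_of_ne hQP)
  obtain ⟨j, hj⟩ := exists_pow_mul_mem_sectionsAt Γ.dim_eq Q.isHomogeneous_ideal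
    Q.not_irrelevant_le hzQ hz (sectionsAt_mul_mem (algebraMap_mem_sectionsAt (K := 𝕂) ⊥ hu) hf0)
  have hzj : z ^ j * u ∈ Γ.grading (j * i + d) :=
    SetLike.GradedMul.mul_mem (by simpa using SetLike.pow_mem_graded j hz) hu
  refine ⟨_, z ^ j * u, hzj, ?_, ?_, fun _ => ⟨_, hzj, ?_⟩⟩
  · intro h
    exact (P.1.isPrime.mem_or_mem h).elim (fun h => hzP (P.1.isPrime.mem_of_pow_mem j h)) huP
  · rw [map_mul, mul_assoc]
    exact isIntegral_algebraMap.mul hint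
  · rwa [map_mul, mul_assoc]

/-- Germs at finitely many points that are jointly linearly independent modulo regular germs. -/
theorem exists_germs (s : Finset Γ.Point) (m : ℕ) (h : (m : ℕ∞) ≤ ∑ P ∈ s, Γ.deltaAt P) :
    ∃ f : s → Fin m → 𝕂, (∀ (P : s) i, IsIntegral (Γ.localRing P.1) (f P i)) ∧
      (∀ (P : s) i, f P i ∈ sectionsAt Γ.grading 𝕂 ⊥ 0) ∧
      ∀ a : Fin m → k, (∀ P : s, ∑ i, a i • f P i ∈ sectionsAt Γ.grading 𝕂 P.1.ideal 0) →
        a = 0 := by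
  obtain ⟨f, hfint, hffrac, hf⟩ := exists_jointly_independent_representatives
    (fun P : Γ.Point => Γ.localRing P) 𝕂 s m h
  refine ⟨f, hfint, fun P i => mem_sectionsAt_bot_of_exists_fraction (hffrac P i),
    fun a ha => hf a fun P => ?_⟩
  obtain ⟨o, ho⟩ := exists_algebraMap_eq_iff.mpr (ha P)
  exact ⟨o, ho.symm⟩

theorem exists_homogeneous_forall_mul_mem_sectionsAt (s : Finset Γ.Point) {m : ℕ} {P : Γ.Point}
    {f : Fin m → 𝕂} (hf : ∀ i, IsIntegral (Γ.localRing P) (f i))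
    (hf0 : ∀ i, f i ∈ sectionsAt Γ.grading 𝕂 ⊥ 0) :
    ∃ d, ∃ u ∈ Γ.grading d, u ∉ P.ideal ∧
      (∀ i, IsIntegral Γ.coordinateRing (algebraMap _ 𝕂 u * f i)) ∧
      ∀ i, ∀ Q ∈ s, Q ≠ P → algebraMap _ 𝕂 u * f i ∈ sectionsAt Γ.grading 𝕂 Q.ideal d := by
  classical
  obtain ⟨e, u, hu, huP, hC⟩ := exists_homogeneous_notMem_forall (𝒜 := Γ.grading)
    ((Finset.univ : Finset (Fin m)) ×ˢ insert P s) P.ideal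
    (fun x u => IsIntegral Γ.coordinateRing (algebraMap _ 𝕂 u * f x.1) ∧ (x.2 ≠ P →
      ∃ e, u ∈ Γ.grading e ∧ algebraMap _ 𝕂 u * f x.1 ∈ sectionsAt Γ.grading 𝕂 x.2.ideal e))
    (fun x _ => exists_homogeneous_mul_mem_sectionsAt (hf x.1) (hf0 x.1) x.2)
    (by
      rintro x u v d hv ⟨hint, h⟩
      have heq : algebraMap _ 𝕂 (u * v) * f x.1 =
          algebraMap _ 𝕂 v * (algebraMap _ 𝕂 u * f x.1) := by
        rw [map_mul]
        ring
      refine ⟨heq ▸ isIntegral_algebraMap.mul hint, fun hne => ?_⟩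
      obtain ⟨e, he, hmem⟩ := h hne
      refine ⟨d + e, ?_, heq ▸ sectionsAt_mul_mem (algebraMap_mem_sectionsAt _ hv) hmem⟩
      rw [mul_comm]
      exact SetLike.GradedMul.mul_mem hv he)
  -- A nonzero homogeneous element has only one degree, so the degrees found for the various `Q` all
  -- agree with `e`.
  have hu0 : u ≠ 0 := fun h => huP (h ▸ P.ideal.zero_mem)
  refine ⟨e, u, hu, huP, fun i => (hC (i, P) (by simp)).1, fun i Q hQ hne => ?_⟩
  obtain ⟨e', he', hmem⟩ := (hC (i, Q) (by simp [hQ])).2 hne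
  rwa [DirectSum.degree_eq_of_mem_mem Γ.grading he' hu hu0] at hmem

/-- Finitely many normalization germs with total dimension at least `m` are induced by `m`
homogeneous fractions which are integral over the coordinate ring, up to twisting. -/
theorem exists_integral_fractions (s : Finset Γ.Point) (m : ℕ)
    (h : (m : ℕ∞) ≤ ∑ P ∈ s, Γ.deltaAt P) :
    ∃ (e : s → ℕ) (g : s → Fin m → 𝕂), (∀ (P : s) i, IsIntegral Γ.coordinateRing (g P i)) ∧
      (∀ (P : s) i, g P i ∈ sectionsAt Γ.grading 𝕂 ⊥ (e P)) ∧
      (∀ (P Q : s) i, Q ≠ P → g P i ∈ sectionsAt Γ.grading 𝕂 Q.1.ideal (e P)) ∧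
      ∀ a : Fin m → k, (∀ P : s, ∑ i, a i • g P i ∈ sectionsAt Γ.grading 𝕂 P.1.ideal (e P)) →
        a = 0 := by
  obtain ⟨f, hfint, hf0, hf⟩ := exists_germs s m h
  choose e u hu huP hint hC using fun P : s =>
    exists_homogeneous_forall_mul_mem_sectionsAt s (hfint P) (hf0 P)
  refine ⟨e, fun P i => algebraMap _ 𝕂 (u P) * f P i, hint, fun P i => ?_,
    fun P Q i hne => hC P i Q Q.2 fun h => hne (Subtype.ext h), fun a ha => hf a fun P => ?_⟩
  · rw [← add_zero (e P)]
    exact sectionsAt_mul_mem (algebraMap_mem_sectionsAt _ (hu P)) (hf0 P i)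
  have h1 := ha P
  simp only [← mul_smul_comm, ← Finset.mul_sum] at h1
  rw [← add_zero (e P)] at h1
  exact mem_sectionsAt_of_mul_mem (n := 0) (hu P) (huP P) h1

/-- Adjoining finitely many integral elements gives a finite module, which has a common denominator;
this suffices in place of finiteness of the whole normalization. Since the algebra is closed under
powers, the same `c` serves for all of them. -/
theorem exists_homogeneous_common_denominator {S : Set 𝕂} (hS : S.Finite)
    (hint : ∀ x ∈ S, IsIntegral Γ.coordinateRing x) :
    ∃ e, ∃ c ∈ Γ.grading e, c ≠ 0 ∧ ∀ n, ∀ x ∈ Algebra.adjoin Γ.coordinateRing S,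
      x ∈ sectionsAt Γ.grading 𝕂 ⊥ n → ∃ y ∈ Γ.grading (e + n),
        algebraMap _ 𝕂 c * x = algebraMap _ 𝕂 y := by
  have hfg := fg_adjoin_of_finite hS hint
  obtain ⟨c, hc, hcB⟩ := FractionalIdeal.isFractional_of_fg
    (S := nonZeroDivisors Γ.coordinateRing) hfg
  have hc0 := nonZeroDivisors.ne_zero hc
  obtain ⟨e, he⟩ := Ideal.IsHomogeneous.exists_decompose_notMem (𝒜 := Γ.grading)
    (P := ⊥) c (by simpa using hc0)
  refine ⟨e, _, SetLike.coe_mem (DirectSum.decompose Γ.grading c e), by simpa using he,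
    fun n x hx hxn => ?_⟩
  obtain ⟨y, hy⟩ := hcB x hx
  exact ⟨_, SetLike.coe_mem _, decompose_mul_mem_of_mul_mem hxn
    (by rw [hy, Algebra.smul_def]) e⟩

/-- If `m ≤ ∑ δ_P`, the normalization has, in every large degree, `m` elements that are linearly
independent modulo the coordinate ring, with a common denominator independent of the degree. -/
theorem exists_sections_of_le_sum_deltaAt (s : Finset Γ.Point) (m : ℕ)
    (h : (m : ℕ∞) ≤ ∑ P ∈ s, Γ.deltaAt P) :
    ∃ e, ∃ c ∈ Γ.grading e, c ≠ 0 ∧ ∀ᶠ n in Filter.atTop, ∃ w : Fin m → 𝕂,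
      (∀ a : Fin m → k, (∃ y ∈ Γ.grading n, ∑ i, a i • w i = algebraMap _ 𝕂 y) → a = 0) ∧
      ∀ (a : Fin m → k), ∀ b ∈ Γ.grading n, ∀ j, ∃ y ∈ Γ.grading (e + j * n),
        algebraMap _ 𝕂 c * (∑ i, a i • w i + algebraMap _ 𝕂 b) ^ j = algebraMap _ 𝕂 y := by
  classical
  obtain ⟨d, g, hint, hbot, hne, hind⟩ := exists_integral_fractions s m h
  choose l hl hlP using fun P : s => Γ.exists_linear_notMem P.1.not_irrelevant_le
  obtain ⟨e, c, hc, hc0, hcB⟩ := exists_homogeneous_common_denominator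
    (Γ := Γ) (S := Set.range fun x : s × Fin m => g x.1 x.2) (Set.finite_range _)
    (by rintro _ ⟨x, rfl⟩; exact hint _ _)
  refine ⟨e, c, hc, hc0, ?_⟩
  filter_upwards [Filter.eventually_ge_atTop (∑ P, d P)] with n hn
  have hdn : ∀ P, n - d P + d P = n := fun P =>
    Nat.sub_add_cancel ((Finset.single_le_sum (fun _ _ => Nat.zero_le _)
      (Finset.mem_univ P)).trans hn)
  have hln : ∀ P, l P ^ (n - d P) ∈ Γ.grading (n - d P) := fun P => by
    simpa using SetLike.pow_mem_graded (n - d P) (hl P)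
  -- Powers of linear forms not vanishing at `P` raise the fractions belonging to `P` to the common
  -- degree `n` without changing their regularity at `P`.
  refine ⟨fun i => ∑ P, algebraMap _ 𝕂 (l P ^ (n - d P)) * g P i, ?_, fun a b hb j => ?_⟩
  · rintro a ⟨y, hy, hay⟩
    refine hind a fun P => ?_
    refine mem_sectionsAt_of_mul_mem (hln P) (fun h => hlP P (P.1.1.isPrime.mem_of_pow_mem _ h)) ?_
    rw [hdn P]
    -- The summands belonging to the other points are regular at `P`, so if the total is a form, the
    -- summand of `P` is regular at `P` as well.
    have h1 : algebraMap _ 𝕂 (l P ^ (n - d P)) * ∑ i, a i • g P i = algebraMap _ 𝕂 y -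
        ∑ Q ∈ Finset.univ.erase P, algebraMap _ 𝕂 (l Q ^ (n - d Q)) * ∑ i, a i • g Q i := by
      rw [← hay, eq_sub_iff_add_eq, Finset.add_sum_erase _ (fun Q =>
        algebraMap _ 𝕂 (l Q ^ (n - d Q)) * ∑ i, a i • g Q i) (Finset.mem_univ P)]
      simp only [Finset.mul_sum, Finset.smul_sum, mul_smul_comm]
      exact Finset.sum_comm
    rw [h1]
    refine sub_mem (algebraMap_mem_sectionsAt _ hy) (Submodule.sum_mem _ fun Q hQ => ?_)
    rw [← hdn Q]
    refine sectionsAt_mul_mem (algebraMap_mem_sectionsAt _ (by simpa using hln Q))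
      (Submodule.sum_mem _ fun i _ =>
        Submodule.smul_mem _ _ (hne Q P i (Finset.ne_of_mem_erase hQ).symm))
  · beta_reduce
    have hsec : ∑ i, a i • (∑ P, algebraMap _ 𝕂 (l P ^ (n - d P)) * g P i) + algebraMap _ 𝕂 b ∈
        sectionsAt Γ.grading 𝕂 ⊥ n := by
      refine add_mem (Submodule.sum_mem _ fun i _ => Submodule.smul_mem _ _
        (Submodule.sum_mem _ fun P _ => ?_)) (algebraMap_mem_sectionsAt _ hb)
      have := sectionsAt_mul_mem (algebraMap_mem_sectionsAt (K := 𝕂) ⊥ (hln P)) (hbot P i)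
      rwa [hdn P] at this
    refine hcB _ _ (Subalgebra.pow_mem _ (add_mem ?_ (Subalgebra.algebraMap_mem _ b)) j)
      (sectionsAt_pow_mem hsec j)
    refine sum_mem fun i _ => ?_
    rw [← algebraMap_smul Γ.coordinateRing]
    refine Subalgebra.smul_mem _ (sum_mem fun P _ => mul_mem (Subalgebra.algebraMap_mem _ _)
      (Algebra.subset_adjoin
        (Set.mem_range_self (f := fun x : s × Fin m => g x.1 x.2) (P, i)))) _

end Gluing

end ProjectiveCurve

/-! ### Integral forms and their reduction modulo `p` -/

open MvPolynomial

namespace ProjectiveCurve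

section IntegralForms

variable {k : Type*} [Field k] {r : ℕ}

/-- The map from integral polynomials to the coordinate ring. -/
noncomputable def ofInt (Γ : ProjectiveCurve k r) :
    MvPolynomial (Fin (r + 1)) ℤ →+* Γ.coordinateRing :=
  (Ideal.Quotient.mk Γ.ideal).comp (MvPolynomial.map (Int.castRingHom k))

theorem ofInt_eq_zero_iff (Γ : ProjectiveCurve k r) {f : MvPolynomial (Fin (r + 1)) ℤ} :
    Γ.ofInt f = 0 ↔ MvPolynomial.map (Int.castRingHom k) f ∈ Γ.ideal :=
  Ideal.Quotient.eq_zero_iff_mem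

theorem ofInt_mem_grading (Γ : ProjectiveCurve k r) {n : ℕ} {f : MvPolynomial (Fin (r + 1)) ℤ}
    (hf : f.IsHomogeneous n) : Γ.ofInt f ∈ Γ.grading n :=
  Γ.mem_grading_iff.mpr ⟨_, hf.map _, rfl⟩

theorem ofInt_homogeneousComponent_eq_zero (Γ : ProjectiveCurve k r) (n : ℕ)
    {f : MvPolynomial (Fin (r + 1)) ℤ} (hf : Γ.ofInt f = 0) :
    Γ.ofInt (homogeneousComponent n f) = 0 := by
  rw [ofInt_eq_zero_iff] at hf ⊢
  have : MvPolynomial.map (Int.castRingHom k) (homogeneousComponent n f) =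
      homogeneousComponent n (MvPolynomial.map (Int.castRingHom k) f) := by
    ext d
    rw [coeff_map, coeff_homogeneousComponent, coeff_homogeneousComponent, coeff_map]
    split_ifs <;> simp
  rw [this]
  exact homogeneousComponent_mem_of_mem Γ.isHomogeneous hf n

theorem exists_smul_eq_ofInt (Γ : ProjectiveCurve ℚ r) {n : ℕ} {a : Γ.coordinateRing}
    (ha : a ∈ Γ.grading n) : ∃ N : ℤ, N ≠ 0 ∧ ∃ f : MvPolynomial (Fin (r + 1)) ℤ,
      f.IsHomogeneous n ∧ (N : Γ.coordinateRing) * a = Γ.ofInt f := by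
  obtain ⟨f, hf, rfl⟩ := Γ.mem_grading_iff.mp ha
  let := MvPolynomial.algebraMvPolynomial (R := ℤ) (S := ℚ) (σ := Fin (r + 1))
  obtain ⟨⟨g, ⟨_, N, hN, rfl⟩⟩, hg⟩ := IsLocalization.surj
    ((nonZeroDivisors ℤ).map (C (σ := Fin (r + 1)))) f
  have hg' : f * C (N : ℚ) = MvPolynomial.map (Int.castRingHom ℚ) g := by
    change f * MvPolynomial.map (Int.castRingHom ℚ) (C N) =
      MvPolynomial.map (Int.castRingHom ℚ) g at hg
    rwa [map_C] at hg
  refine ⟨N, nonZeroDivisors.ne_zero hN, g, ?_, ?_⟩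
  · refine IsHomogeneous.of_map (f := Int.castRingHom ℚ) Int.cast_injective ?_
    rw [← hg', ← add_zero n]
    exact hf.mul (isHomogeneous_C _ _)
  · rw [ofInt, RingHom.comp_apply, ← hg', map_mul, mul_comm]
    simp

end IntegralForms

section Reduction

variable {r : ℕ} {Γ : ProjectiveCurve ℚ r} {p : ℕ} [hp : Fact p.Prime]
  {Γp : ProjectiveCurve (ZMod p) r}

theorem exists_ofInt_eq (Γp : ProjectiveCurve (ZMod p) r) {n : ℕ} {b : Γp.coordinateRing}
    (hb : b ∈ Γp.grading n) :
    ∃ f : MvPolynomial (Fin (r + 1)) ℤ, f.IsHomogeneous n ∧ Γp.ofInt f = b := by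
  obtain ⟨g, hg, rfl⟩ := Γp.mem_grading_iff.mp hb
  obtain ⟨f, rfl⟩ := MvPolynomial.map_surjective (Int.castRingHom (ZMod p))
    ZMod.intCast_surjective g
  refine ⟨homogeneousComponent n f, homogeneousComponent_isHomogeneous n f, ?_⟩
  rw [ofInt, RingHom.comp_apply]
  congr 1
  ext d
  rw [coeff_map, coeff_homogeneousComponent, coeff_map]
  split_ifs with h
  · rfl
  · rw [map_zero]
    by_contra h0
    refine h ?_
    have := hg (d := d) (by rw [coeff_map]; exact fun h => h0 h.symm)
    exact (DFunLike.congr_fun Finsupp.degree_eq_weight_one d).trans this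

theorem ofInt_eq_zero_of_ofInt_eq_zero (hΓp : Γp.ideal = reductionMod Γ.ideal p)
    {f : MvPolynomial (Fin (r + 1)) ℤ} (hf : Γ.ofInt f = 0) : Γp.ofInt f = 0 := by
  rw [ofInt_eq_zero_iff] at hf ⊢
  rw [hΓp]
  exact Ideal.mem_map_of_mem _ hf

/-- Reduction of polynomials is surjective, so every element of the reduced ideal lifts to an
integral element of `I(Γ)`; subtracting the lift leaves a multiple of `p`. -/
theorem exists_ofInt_eq_prime_mul (hΓp : Γp.ideal = reductionMod Γ.ideal p)
    {f : MvPolynomial (Fin (r + 1)) ℤ} (hf : Γp.ofInt f = 0) :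
    ∃ g, Γ.ofInt f = p * Γ.ofInt g := by
  rw [ofInt_eq_zero_iff, hΓp, reductionMod,
    Ideal.mem_map_iff_of_surjective _ (MvPolynomial.map_surjective (Int.castRingHom (ZMod p))
      ZMod.intCast_surjective)] at hf
  obtain ⟨t, ht, htf⟩ := hf
  have h1 : MvPolynomial.map (Int.castRingHom (ZMod p)) (f - t) = 0 := by
    rw [map_sub, htf]
    exact sub_self _
  obtain ⟨g, hg⟩ := (C_dvd_iff_zmod p (f - t)).mpr h1
  refine ⟨g, ?_⟩
  have ht0 : Γ.ofInt t = 0 := Γ.ofInt_eq_zero_iff.mpr ht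
  rw [eq_add_of_sub_eq hg, map_add, ht0, add_zero, map_mul]
  simp

theorem exists_homogeneous_ofInt_eq_prime_mul (hΓp : Γp.ideal = reductionMod Γ.ideal p) {n : ℕ}
    {f : MvPolynomial (Fin (r + 1)) ℤ} (hfn : f.IsHomogeneous n) (hf : Γp.ofInt f = 0) :
    ∃ g : MvPolynomial (Fin (r + 1)) ℤ, g.IsHomogeneous n ∧ Γ.ofInt f = p * Γ.ofInt g := by
  obtain ⟨g, hg⟩ := exists_ofInt_eq_prime_mul hΓp hf
  refine ⟨homogeneousComponent n g, homogeneousComponent_isHomogeneous n g, ?_⟩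
  have h1 : Γ.ofInt (f - C (p : ℤ) * g) = 0 := by
    rw [map_sub, hg, map_mul]
    simp
  have h2 := Γ.ofInt_homogeneousComponent_eq_zero n h1
  rw [map_sub, homogeneousComponent_C_mul, homogeneousComponent_eq_self hfn, map_sub, map_mul,
    sub_eq_zero] at h2
  simpa using h2

theorem prime_mul_cancel {x y : Γ.coordinateRing} (h : (p : Γ.coordinateRing) * x = p * y) :
    x = y := by
  have : CharZero Γ.coordinateRing := algebraRat.charZero _
  exact mul_left_cancel₀ (Nat.cast_ne_zero.mpr hp.out.ne_zero) h

/-- If `f / c` is regular on the generic fibre and `c` does not vanish on the special fibre, then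
`f / c` is regular on the special fibre. -/
theorem ofInt_dvd_ofInt (hΓp : Γp.ideal = reductionMod Γ.ideal p)
    {c f : MvPolynomial (Fin (r + 1)) ℤ} (hc : Γp.ofInt c ≠ 0) {d : ℕ} {y : Γ.coordinateRing}
    (hy : y ∈ Γ.grading d) (h : Γ.ofInt f = Γ.ofInt c * y) : Γp.ofInt c ∣ Γp.ofInt f := by
  have : CharZero Γ.coordinateRing := algebraRat.charZero _
  obtain ⟨N, hN, g, hgd, hg⟩ := Γ.exists_smul_eq_ofInt hy
  clear hy hgd
  -- Here `N * y` is the integral form `g`, so `N * f = c * g`. If `p` divides `N`, then `c * g`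
  -- vanishes modulo `p`, hence so does `g`, and a factor `p` cancels from both. Otherwise `N` is
  -- invertible modulo `p`.
  induction hM : N.natAbs using Nat.strong_induction_on generalizing N g with
  | _ M ih =>
    have h1 : Γ.ofInt (C N * f - c * g) = 0 := by
      rw [map_sub, map_mul, map_mul, h, ← hg]
      simp
      ring
    have h2 := ofInt_eq_zero_of_ofInt_eq_zero hΓp h1
    rw [map_sub, map_mul, map_mul, sub_eq_zero] at h2
    have hC : Γp.ofInt (C N) = algebraMap (ZMod p) _ (N : ZMod p) := by simp
    rw [hC] at h2
    by_cases hpN : (N : ZMod p) = 0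
    · rw [hpN, map_zero, zero_mul, eq_comm, mul_eq_zero, or_iff_right hc] at h2
      obtain ⟨g', hg'⟩ := exists_ofInt_eq_prime_mul hΓp h2
      obtain ⟨N', rfl⟩ := (ZMod.intCast_zmod_eq_zero_iff_dvd N p).mp hpN
      have hN' : N' ≠ 0 := right_ne_zero_of_mul hN
      refine ih N'.natAbs ?_ N' hN' g' (prime_mul_cancel (p := p) ?_) rfl
      · rw [← hM, Int.natAbs_mul, Int.natAbs_natCast]
        exact lt_mul_of_one_lt_left (Int.natAbs_pos.mpr hN') hp.out.one_lt
      · rw [← hg', ← hg]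
        push_cast
        ring
    · refine ⟨algebraMap (ZMod p) _ (N : ZMod p)⁻¹ * Γp.ofInt g, ?_⟩
      rw [mul_left_comm, ← h2, ← mul_assoc, ← map_mul, inv_mul_cancel₀ hpN, map_one, one_mul]

/-- The lattice of integral forms of degree `n`. -/
noncomputable def integralForms (Γ : ProjectiveCurve ℚ r) (n : ℕ) : Submodule ℤ Γ.coordinateRing :=
  (homogeneousSubmodule (Fin (r + 1)) ℤ n).map Γ.ofInt.toAddMonoidHom.toIntLinearMap

theorem mem_integralForms {n : ℕ} {a : Γ.coordinateRing} :
    a ∈ Γ.integralForms n ↔ ∃ f : MvPolynomial (Fin (r + 1)) ℤ, f.IsHomogeneous n ∧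
      Γ.ofInt f = a := Iff.rfl

theorem integralForms_fg (Γ : ProjectiveCurve ℚ r) (n : ℕ) : (Γ.integralForms n).FG :=
  (homogeneousSubmodule_fg _ _ n).map _

/-- A nonzero integral form is, up to a power of `p`, nonzero on the special fibre. -/
theorem exists_ofInt_ne_zero (hΓp : Γp.ideal = reductionMod Γ.ideal p) {n : ℕ}
    {f : MvPolynomial (Fin (r + 1)) ℤ} (hfn : f.IsHomogeneous n) (hf : Γ.ofInt f ≠ 0) :
    ∃ g : MvPolynomial (Fin (r + 1)) ℤ, g.IsHomogeneous n ∧ Γp.ofInt g ≠ 0 ∧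
      ∃ j, Γ.ofInt f = p ^ j * Γ.ofInt g := by
  by_contra! h
  -- If the process never stopped, `f` would be divisible by every power of `p` in a finitely
  -- generated torsion-free `ℤ`-module, against Krull's intersection theorem.
  have hdiv : ∀ j, ∃ g : MvPolynomial (Fin (r + 1)) ℤ, g.IsHomogeneous n ∧
      Γ.ofInt f = p ^ j * Γ.ofInt g := by
    intro j
    induction j with
    | zero => exact ⟨f, hfn, by simp⟩
    | succ j ih =>
      obtain ⟨g, hg, hfg⟩ := ih
      have hg0 : Γp.ofInt g = 0 := by
        by_contra h0
        exact h g hg h0 j hfg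
      obtain ⟨g', hg', hgg'⟩ := exists_homogeneous_ofInt_eq_prime_mul hΓp hg hg0
      exact ⟨g', hg', by rw [hfg, hgg', pow_succ, mul_assoc]⟩
  have : CharZero Γ.coordinateRing := algebraRat.charZero _
  have : Module.Finite ℤ (Γ.integralForms n) := Module.Finite.iff_fg.mpr (Γ.integralForms_fg n)
  have hI : Ideal.span {(p : ℤ)} ≠ ⊤ := by
    rw [Ne, Ideal.span_singleton_eq_top, Int.ofNat_isUnit]
    exact hp.out.one_lt.ne' ∘ Nat.isUnit_iff.mp
  have hbot := Ideal.iInf_pow_smul_eq_bot_of_isTorsionFree (M := Γ.integralForms n) _ hI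
  have hmem : (⟨Γ.ofInt f, mem_integralForms.mpr ⟨f, hfn, rfl⟩⟩ : Γ.integralForms n) ∈
      (⨅ j : ℕ, Ideal.span {(p : ℤ)} ^ j • ⊤ : Submodule ℤ (Γ.integralForms n)) := by
    rw [Submodule.mem_iInf]
    intro j
    obtain ⟨g, hg, hfg⟩ := hdiv j
    rw [Ideal.span_singleton_pow, Submodule.ideal_span_singleton_smul]
    refine ⟨⟨Γ.ofInt g, mem_integralForms.mpr ⟨g, hg, rfl⟩⟩, trivial, Subtype.ext ?_⟩
    refine Eq.trans ?_ hfg.symm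
    simp
  rw [hbot, Submodule.mem_bot] at hmem
  exact hf (congrArg Subtype.val hmem)

end Reduction

end ProjectiveCurve

/-! ### Lattices of integral fractions and their specialisation -/

/-- A finitely generated lattice in a rational vector space that contains multiples of `m` vectors
that are linearly independent modulo `U` has, modulo `U`, an integral basis with at least `m`
elements. -/
theorem exists_integral_basis_mod {X : Type*} [AddCommGroup X] [Module ℚ X] (U : Submodule ℚ X)
    {W : Submodule ℤ X} (hW : W.FG) {m : ℕ} {w : Fin m → X}
    (hw : ∀ a : Fin m → ℚ, ∑ i, a i • w i ∈ U → a = 0)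
    (hwW : ∀ i, ∃ N : ℤ, N ≠ 0 ∧ N • w i ∈ W) :
    ∃ d, m ≤ d ∧ ∃ v : Fin d → X, (∀ i, v i ∈ W) ∧
      (∀ z : Fin d → ℤ, ∑ i, z i • v i ∈ U → z = 0) ∧
      ∀ x ∈ W, ∃ z : Fin d → ℤ, x - ∑ i, z i • v i ∈ U := by
  let π : X →ₗ[ℤ] (X ⧸ U) := U.mkQ.restrictScalars ℤ
  have hπ : ∀ x, π x = 0 ↔ x ∈ U := fun x => Submodule.Quotient.mk_eq_zero _
  let L := W.map π
  have : Module.Finite ℤ L := Module.Finite.iff_fg.mpr (hW.map π)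
  -- The image of the lattice sits in a rational vector space, so it is torsion-free, and being
  -- finitely generated it is free.
  have : Module.IsTorsionFree ℤ (X ⧸ U) := Module.IsTorsionFree.trans ℚ
  let b := Module.finBasis ℤ L
  have hb : ∀ i, ∃ v ∈ W, π v = b i := fun i => (b i).2
  choose v hv hvb using hb
  refine ⟨Module.finrank ℤ L, ?_, v, hv, fun z hz => ?_, fun x hx => ?_⟩
  · choose N hN hmem using hwW
    let u : Fin m → L := fun i => ⟨π (N i • w i), _, hmem i, rfl⟩
    have hu : LinearIndependent ℤ u := by
      rw [Fintype.linearIndependent_iff]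
      intro z hz
      have h1 : ∑ i, ((z i * N i : ℤ) : ℚ) • w i ∈ U := by
        rw [← hπ]
        have h1 := congrArg Subtype.val hz
        simp only [AddSubmonoidClass.coe_finsetSum, Submodule.coe_smul, u, ← map_smul] at h1
        rw [← map_sum] at h1
        simp only [Int.cast_smul_eq_zsmul, mul_smul]
        exact h1
      have h2 := hw _ h1
      intro i
      have h3 : ((z i * N i : ℤ) : ℚ) = 0 := congrFun h2 i
      exact (mul_eq_zero.mp (Int.cast_eq_zero.mp h3)).resolve_right (hN i)
    simpa using hu.fintype_card_le_finrank
  · rw [← hπ, map_sum] at hz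
    refine funext (Fintype.linearIndependent_iff.mp b.linearIndependent z (Subtype.ext ?_))
    simpa [hvb] using hz
  · let x' : L := ⟨π x, x, hx, rfl⟩
    refine ⟨b.repr x', ?_⟩
    have := congrArg Subtype.val (b.sum_repr x')
    rw [← hπ, map_sub, map_sum, sub_eq_zero]
    refine this.symm.trans ?_
    rw [AddSubmonoidClass.coe_finsetSum]
    simp [hvb]

theorem natCast_zsmul_inv_smul {X : Type*} [AddCommGroup X] [Module ℚ X] {p : ℕ} (hp : p ≠ 0)
    (x : X) : (p : ℤ) • (p : ℚ)⁻¹ • x = x := by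
  rw [← Int.cast_smul_eq_zsmul ℚ, smul_smul, Int.cast_natCast,
    mul_inv_cancel₀ (Nat.cast_ne_zero.mpr hp), one_smul]

theorem sum_single_smul {R X ι : Type*} [Semiring R] [AddCommMonoid X] [Module R X] [Fintype ι]
    [DecidableEq ι] (w : ι → X) (i : ι) (c : R) :
    ∑ j, (Pi.single i c : ι → R) j • w j = c • w i := by
  rw [Finset.sum_eq_single i, Pi.single_eq_same]
  · intro j _ hj
    rw [Pi.single_eq_of_ne hj, zero_smul]
  · simp


namespace ProjectiveCurve

section Lattice

variable {r : ℕ} {Γ : ProjectiveCurve ℚ r}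

variable (Γ) (K : Type*) [Field K] [Algebra Γ.coordinateRing K] [Algebra ℚ K]
  [IsScalarTower ℚ Γ.coordinateRing K]

/-- The forms of degree `n`, as a subspace of the fraction field. -/
noncomputable def forms (n : ℕ) : Submodule ℚ K :=
  (Γ.grading n).map (IsScalarTower.toAlgHom ℚ Γ.coordinateRing K).toLinearMap

/-- The elements of the span of the `w i` and of the forms of degree `n` whose product with `c` is
an integral form. -/
noncomputable def integralFractions (n e : ℕ) (c : Γ.coordinateRing)
    {m : ℕ} (w : Fin m → K) : Submodule ℤ K :=
  AddSubgroup.toIntSubmodule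
    { carrier := {v | v ∈ Submodule.span ℚ (Set.range w) ⊔ Γ.forms K n ∧
        ∃ f : MvPolynomial (Fin (r + 1)) ℤ, f.IsHomogeneous (e + n) ∧
          algebraMap Γ.coordinateRing K c * v = algebraMap Γ.coordinateRing K (Γ.ofInt f)}
      zero_mem' := ⟨zero_mem _, 0, isHomogeneous_zero _ _ _, by simp⟩
      add_mem' := by
        rintro _ _ ⟨hv, f, hf, h⟩ ⟨hv', f', hf', h'⟩
        exact ⟨add_mem hv hv', f + f', hf.add hf', by rw [mul_add, h, h', map_add, map_add]⟩
      neg_mem' := by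
        rintro _ ⟨hv, f, hf, h⟩
        exact ⟨neg_mem hv, -f, hf.neg, by rw [mul_neg, h, map_neg, map_neg]⟩ }

variable {Γ K}

theorem mem_integralFractions {n e : ℕ} {c : Γ.coordinateRing} {m : ℕ} {w : Fin m → K} {v : K} :
    v ∈ Γ.integralFractions K n e c w ↔ v ∈ Submodule.span ℚ (Set.range w) ⊔ Γ.forms K n ∧
        ∃ f : MvPolynomial (Fin (r + 1)) ℤ, f.IsHomogeneous (e + n) ∧
          algebraMap Γ.coordinateRing K c * v = algebraMap Γ.coordinateRing K (Γ.ofInt f) :=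
  Iff.rfl

/-- Multiplication by `c` embeds it in the finitely generated lattice of integral forms of degree `e
+ n`. -/
theorem integralFractions_fg [FaithfulSMul Γ.coordinateRing K] {n e : ℕ} {c : Γ.coordinateRing} (hc : c ≠ 0) {m : ℕ}
    (w : Fin m → K) : (Γ.integralFractions K n e c w).FG := by
  have hc' : algebraMap Γ.coordinateRing K c ≠ 0 := by
    rwa [Ne, FaithfulSMul.algebraMap_eq_zero_iff]
  refine Submodule.fg_of_fg_map_injective (LinearMap.mulLeft ℤ (algebraMap Γ.coordinateRing K c))
    (mul_right_injective₀ hc') ?_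
  have hfg := (Γ.integralForms_fg (e + n)).map
    (algebraMap Γ.coordinateRing K).toAddMonoidHom.toIntLinearMap
  have : IsNoetherian ℤ _ := isNoetherian_of_fg_of_noetherian _ hfg
  refine Submodule.FG.of_le hfg ?_
  rintro _ ⟨v, ⟨_, f, hf, h⟩, rfl⟩
  exact ⟨Γ.ofInt f, mem_integralForms.mpr ⟨f, hf, rfl⟩, h.symm⟩

theorem exists_zsmul_mem_integralFractions {n e : ℕ} {c : Γ.coordinateRing} {m : ℕ}
    {w : Fin m → K} (i : Fin m)
    (h : ∃ y ∈ Γ.grading (e + n), algebraMap _ K c * w i = algebraMap _ K y) :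
    ∃ N : ℤ, N ≠ 0 ∧ N • w i ∈ Γ.integralFractions K n e c w := by
  obtain ⟨y, hy, hcy⟩ := h
  obtain ⟨N, hN, f, hf, hNf⟩ := Γ.exists_smul_eq_ofInt hy
  refine ⟨N, hN, mem_integralFractions.mpr ⟨?_, f, hf, ?_⟩⟩
  · exact zsmul_mem (Submodule.mem_sup_left (Submodule.subset_span (Set.mem_range_self i))) N
  · rw [mul_smul_comm, hcy, ← hNf, map_mul, map_intCast, zsmul_eq_mul]

theorem exists_eq_sum_add_of_mem_sup {n m : ℕ} {w : Fin m → K} {v : K}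
    (hv : v ∈ Submodule.span ℚ (Set.range w) ⊔ Γ.forms K n) :
    ∃ a : Fin m → ℚ, ∃ b ∈ Γ.grading n, v = ∑ i, a i • w i + algebraMap _ K b := by
  obtain ⟨x, hx, _, ⟨b, hb, rfl⟩, rfl⟩ := Submodule.mem_sup.mp hv
  obtain ⟨a, rfl⟩ := (Submodule.mem_span_range_iff_exists_fun ℚ).mp hx
  exact ⟨a, b, hb, rfl⟩

variable {p : ℕ} [hp : Fact p.Prime] {Γp : ProjectiveCurve (ZMod p) r}

/-- Elements of the normalization of the generic fibre, linearly independent modulo forms, produce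
at least as many elements of the normalization of the special fibre. -/
theorem exists_reduction [FaithfulSMul Γ.coordinateRing K] (hΓp : Γp.ideal = reductionMod Γ.ideal p) {n e m : ℕ}
    {c : MvPolynomial (Fin (r + 1)) ℤ} (hce : c.IsHomogeneous e) (hc : Γp.ofInt c ≠ 0)
    (w : Fin m → K)
    (hw : ∀ a : Fin m → ℚ, (∃ y ∈ Γ.grading n, ∑ i, a i • w i = algebraMap _ K y) → a = 0)
    (hcw : ∀ (a : Fin m → ℚ), ∀ b ∈ Γ.grading n, ∀ j, ∃ y ∈ Γ.grading (e + j * n),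
      algebraMap _ K (Γ.ofInt c) * (∑ i, a i • w i + algebraMap _ K b) ^ j = algebraMap _ K y) :
    ∃ d, m ≤ d ∧ ∃ G : Fin d → Γp.coordinateRing, (∀ i, G i ∈ Γp.grading (e + n)) ∧
      (∀ a : Fin d → ZMod p, (∃ b ∈ Γp.grading n, ∑ i, a i • G i = Γp.ofInt c * b) → a = 0) ∧
      ∀ i j, Γp.ofInt c ^ j ∣ Γp.ofInt c * G i ^ j := by
  have hc0 : Γ.ofInt c ≠ 0 := fun h => hc (ofInt_eq_zero_of_ofInt_eq_zero hΓp h)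
  have hinj := FaithfulSMul.algebraMap_injective Γ.coordinateRing K
  obtain ⟨d, hd, v, hv, hind, hspan⟩ := exists_integral_basis_mod (Γ.forms K n)
    (integralFractions_fg (n := n) (e := e) hc0 w)
    (fun a ha => hw a (by obtain ⟨y, hy, h⟩ := ha; exact ⟨y, hy, h.symm⟩))
    (fun i => exists_zsmul_mem_integralFractions i (by
      obtain ⟨y, hy, h⟩ := hcw (Pi.single i 1) 0 (zero_mem _) 1
      refine ⟨y, by rwa [one_mul] at hy, ?_⟩
      rw [← h, pow_one, map_zero, add_zero, sum_single_smul, one_smul]))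
  choose hv1 E hE hvE using fun i => mem_integralFractions.mp (hv i)
  refine ⟨d, hd, fun i => Γp.ofInt (E i), fun i => Γp.ofInt_mem_grading (hE i), ?_, fun i j => ?_⟩
  · rintro a ⟨b, hb, hab⟩
    obtain ⟨f, hf, rfl⟩ := exists_ofInt_eq Γp hb
    choose z hz using fun i => ZMod.intCast_surjective (a i)
    have hF : (∑ i, C (z i) * E i - c * f).IsHomogeneous (e + n) := by
      refine IsHomogeneous.sub (IsHomogeneous.sum _ _ _ fun i _ => ?_) (hce.mul hf)
      rw [← zero_add (e + n)]
      exact (isHomogeneous_C _ _).mul (hE i)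
    have hF0 : Γp.ofInt (∑ i, C (z i) * E i - c * f) = 0 := by
      rw [map_sub, map_mul, ← hab, map_sum, sub_eq_zero]
      refine Finset.sum_congr rfl fun i _ => ?_
      beta_reduce
      have hC : Γp.ofInt (C (z i)) = algebraMap (ZMod p) _ (z i : ZMod p) := by simp
      rw [map_mul, ← hz, hC]
      exact (Algebra.smul_def _ _).symm
    obtain ⟨g, hg, hFg⟩ := exists_homogeneous_ofInt_eq_prime_mul hΓp hF hF0
    have hy : algebraMap _ K (Γ.ofInt f) ∈ Γ.forms K n := ⟨_, Γ.ofInt_mem_grading hf, rfl⟩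
    set y : K := ∑ i, z i • v i - algebraMap _ K (Γ.ofInt f) with hydef
    have hcy : algebraMap _ K (Γ.ofInt c) * y = (p : ℤ) • algebraMap _ K (Γ.ofInt g) := by
      rw [natCast_zsmul, nsmul_eq_mul, ← map_natCast (algebraMap Γ.coordinateRing K), ← map_mul,
        ← hFg, hydef, mul_sub, map_sub, map_sub, map_mul, map_mul, Finset.mul_sum, map_sum, map_sum]
      congr 1
      refine Finset.sum_congr rfl fun i _ => ?_
      rw [mul_smul_comm, hvE, map_mul, map_mul, zsmul_eq_mul]
      simp
    have hpx := natCast_zsmul_inv_smul hp.out.ne_zero y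
    -- Independence rests on this saturation: `c * y` is `p` times an integral form, so `y / p`
    -- belongs to the lattice. Expanding it in the basis modulo forms shows that every `z i` is
    -- divisible by `p`.
    have hx : (p : ℚ)⁻¹ • y ∈ Γ.integralFractions K n e (Γ.ofInt c) w := by
      refine mem_integralFractions.mpr ⟨Submodule.smul_mem _ _ (sub_mem
        (sum_mem fun i _ => zsmul_mem (hv1 i) _) (Submodule.mem_sup_right hy)), g, hg, ?_⟩
      rw [mul_smul_comm, hcy, ← Int.cast_smul_eq_zsmul ℚ, smul_smul, Int.cast_natCast,
        inv_mul_cancel₀ (Nat.cast_ne_zero.mpr hp.out.ne_zero), one_smul]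
    obtain ⟨z', hz'⟩ := hspan _ hx
    have h1 := hind (fun i => z i - p * z' i) (by
      have := add_mem (zsmul_mem hz' (p : ℤ)) hy
      rw [smul_sub, hpx, Finset.smul_sum] at this
      convert! this using 1
      simp only [sub_smul, Finset.sum_sub_distrib, mul_smul, hydef]
      ring)
    funext i
    have h2 : z i = p * z' i := sub_eq_zero.mp (congrFun h1 i)
    rw [← hz, h2]
    simp
  · obtain ⟨a, b, hb, hvab⟩ := exists_eq_sum_add_of_mem_sup (hv1 i)
    obtain ⟨y, hy, h⟩ := hcw a b hb j
    rw [← hvab] at h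
    beta_reduce
    rw [← map_pow, ← map_pow, ← map_mul]
    -- Multiplying `c * v ^ j = y` by `c ^ j` gives `c * E ^ j = c ^ j * y`, a divisibility over `ℚ`
    -- that descends to the special fibre.
    refine ofInt_dvd_ofInt hΓp (by rw [map_pow]; exact pow_ne_zero j hc) hy (hinj ?_)
    rw [map_mul Γ.ofInt, map_mul, map_mul, ← h, map_pow Γ.ofInt, map_pow Γ.ofInt, map_pow, map_pow,
      ← hvE i]
    ring

end Lattice

end ProjectiveCurve

/-! ### Bounding `δ` from below by integral fractions -/

/-- Integral elements with values in a common field bound the sum of the delta invariants from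
below. -/
theorem finrank_le_tsum_deltaInvariant {k ι V : Type*} [Field k] [AddCommGroup V] [Module k V]
    [Module.Finite k V] (O : ι → Type*) [∀ i, CommRing (O i)] [∀ i, IsDomain (O i)]
    [∀ i, Algebra k (O i)] {K : Type*} [Field K] [Algebra k K] [∀ i, Algebra (O i) K]
    [∀ i, FaithfulSMul (O i) K] [∀ i, IsScalarTower k (O i) K] (g : ι → V →ₗ[k] K)
    (hint : ∀ i v, IsIntegral (O i) (g i v))
    (hfrac : ∀ i v, ∃ a b : O i, b ≠ 0 ∧ algebraMap (O i) K b * g i v = algebraMap (O i) K a)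
    (h : ∀ v, (∀ i, ∃ o : O i, g i v = algebraMap (O i) K o) → v = 0) :
    (Module.finrank k V : ℕ∞) ≤ ∑' i, deltaInvariant k (O i) := by
  choose ψ hψ using fun i => exists_linearMap_deltaModule (g i) (hint i) (hfrac i)
  exact finrank_le_tsum_rank (fun i => DeltaModule (O i)) ψ fun v hv =>
    h v fun i => hψ i v (hv i)

/-- The divisibilities say that `c * x ^ j` lies in `A` for all `j`, so `x` is almost integral,
which over a noetherian domain means integral. -/
theorem isIntegral_of_forall_pow_dvd {A K : Type*} [CommRing A] [IsDomain A] [IsNoetherianRing A]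
    [Field K] [Algebra A K] [FaithfulSMul A K] {c : A} (hc : c ≠ 0) {x : K} {G : A}
    (hx : algebraMap A K c * x = algebraMap A K G) (h : ∀ j, c ^ j ∣ c * G ^ j) :
    IsIntegral A x := by
  have hc' : algebraMap A K c ≠ 0 := by
    rwa [Ne, FaithfulSMul.algebraMap_eq_zero_iff]
  refine IsAlmostIntegral.isIntegral_of_nonZeroDivisors_le_comap
    ⟨c, mem_nonZeroDivisors_of_ne_zero hc, fun j => ?_⟩ ?_
  · obtain ⟨y, hy⟩ := h j
    refine ⟨y, mul_left_cancel₀ (pow_ne_zero j hc') ?_⟩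
    rw [← map_pow, ← map_mul, ← hy, map_mul, map_pow, map_pow, ← hx, Algebra.smul_def, mul_pow]
    ring
  · intro y hy
    refine mem_nonZeroDivisors_of_ne_zero ?_
    rw [Ne, FaithfulSMul.algebraMap_eq_zero_iff]
    exact nonZeroDivisors.ne_zero hy

namespace ProjectiveCurve

theorem tsum_deltaAt {k : Type*} [Field k] {r : ℕ} (Γ : ProjectiveCurve k r) :
    ∑' P : Γ.Point, Γ.deltaAt P = Γ.delta := by
  refine (tsum_subtype_eq_of_support_subset fun P hP => ?_).symm
  by_contra h
  exact hP (deltaAt_eq_zero_of_notMem_singularLocus h)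

variable {k : Type*} [Field k] {r : ℕ} {Γ : ProjectiveCurve k r}

/-- In large degrees, divisibility by a form can be tested at the closed points. -/
theorem eventually_dvd_of_forall_point {e : ℕ} {c : Γ.coordinateRing} (hc : c ∈ Γ.grading e)
    (hc0 : c ≠ 0) : ∀ᶠ n in Filter.atTop, ∀ g ∈ Γ.grading n,
      (∀ P : Γ.Point, ∃ b, b ∉ P.ideal ∧ c ∣ b * g) → c ∣ g := by
  filter_upwards [eventually_dvd_of_irrelevant_pow_mul_dvd
    (fun _ _ ha => Γ.mem_irrelevant_pow ha) hc] with n hn g hg h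
  refine hn g hg (exists_irrelevant_pow_mul_dvd hc0 hc hg fun P hP hPh hP0 hPirr => ?_)
  obtain ⟨Q, rfl⟩ := exists_point_ideal_eq hP hPh hP0 hPirr
  exact h Q

theorem exists_mem_grading_of_dvd {e n : ℕ} {c g : Γ.coordinateRing} (hc : c ∈ Γ.grading e)
    (hg : g ∈ Γ.grading (e + n)) (h : c ∣ g) : ∃ b ∈ Γ.grading n, g = c * b := by
  classical
  obtain ⟨b, rfl⟩ := h
  refine ⟨_, SetLike.coe_mem (DirectSum.decompose Γ.grading b n), ?_⟩
  rw [← DirectSum.coe_decompose_mul_add_of_left_mem Γ.grading hc]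
  exact (DirectSum.decompose_of_mem_same Γ.grading hg).symm

local notation "𝕂" => FractionRing Γ.coordinateRing

/-- Integral fractions of large degree with denominator `c`, linearly independent modulo forms,
bound the delta invariant from below. -/
theorem eventually_le_delta {e : ℕ} {c : Γ.coordinateRing} (hc : c ∈ Γ.grading e) (hc0 : c ≠ 0) :
    ∀ᶠ n in Filter.atTop, ∀ (d : ℕ) (G : Fin d → Γ.coordinateRing),
      (∀ i, G i ∈ Γ.grading (e + n)) →
      (∀ a : Fin d → k, (∃ b ∈ Γ.grading n, ∑ i, a i • G i = c * b) → a = 0) →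
      (∀ i j, c ^ j ∣ c * G i ^ j) → (d : ℕ∞) ≤ Γ.delta := by
  have hev := (Filter.tendsto_add_atTop_nat e).eventually (eventually_dvd_of_forall_point hc hc0)
  filter_upwards [hev] with n hn d G hG hind hdvd
  rw [add_comm n e] at hn
  have hc' : algebraMap _ 𝕂 c ≠ 0 := by
    rwa [Ne, FaithfulSMul.algebraMap_eq_zero_iff]
  choose l hl hlP using fun P : Γ.Point => Γ.exists_linear_notMem P.not_irrelevant_le
  have hln : ∀ P, l P ^ n ∈ Γ.grading n := fun P => by
    simpa using SetLike.pow_mem_graded n (hl P)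
  have hlnP : ∀ P, l P ^ n ∉ P.ideal := fun P h => hlP P (P.1.isPrime.mem_of_pow_mem n h)
  have hl' : ∀ P, algebraMap _ 𝕂 (l P ^ n) ≠ 0 := fun P => by
    rw [Ne, FaithfulSMul.algebraMap_eq_zero_iff]
    exact fun h => hlnP P (h ▸ P.ideal.zero_mem)
  let x : Fin d → 𝕂 := fun i => algebraMap _ 𝕂 (G i) / algebraMap _ 𝕂 c
  have hcx : ∀ i, algebraMap _ 𝕂 c * x i = algebraMap _ 𝕂 (G i) := fun i =>
    mul_div_cancel₀ _ hc'
  have hx : ∀ i, IsIntegral Γ.coordinateRing (x i) := fun i =>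
    isIntegral_of_forall_pow_dvd hc0 (hcx i) (hdvd i)
  let y : (Fin d → k) → 𝕂 := fun a => ∑ i, a i • x i
  have hy : ∀ a, IsIntegral Γ.coordinateRing (y a) := fun a => by
    refine IsIntegral.sum _ fun i _ => ?_
    rw [← algebraMap_smul Γ.coordinateRing (a i) (x i)]
    exact (integralClosure Γ.coordinateRing 𝕂).smul_mem (hx i) _
  have hcy : ∀ a, algebraMap _ 𝕂 c * y a = algebraMap _ 𝕂 (∑ i, a i • G i) := fun a => by
    simp only [y, Finset.mul_sum, mul_smul_comm, hcx, map_sum, algebraMap.coe_smul]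
  have hGa : ∀ a : Fin d → k, ∑ i, a i • G i ∈ Γ.grading (e + n) := fun a =>
    Submodule.sum_mem _ fun i _ => Submodule.smul_mem _ _ (hG i)
  -- Dividing by `l P ^ n`, a unit at `P` up to degree, turns a fraction of degree `n` into a germ
  -- of degree zero at `P`.
  let g : Γ.Point → (Fin d → k) →ₗ[k] 𝕂 := fun P =>
    Fintype.linearCombination k fun i => (algebraMap _ 𝕂 (l P ^ n))⁻¹ * x i
  have hg : ∀ P a, algebraMap _ 𝕂 (l P ^ n) * g P a = y a := fun P a => by
    simp only [g, y, Fintype.linearCombination_apply, Finset.mul_sum, mul_smul_comm,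
      mul_inv_cancel_left₀ (hl' P)]
  have hsec : ∀ P a, g P a ∈ sectionsAt Γ.grading 𝕂 (⊥ : Ideal Γ.coordinateRing) 0 :=
    fun P a => by
      refine mem_sectionsAt.mpr ⟨e + n, c * l P ^ n, SetLike.GradedMul.mul_mem hc (hln P), ?_,
        _, hGa a, ?_⟩
      · exact mul_ne_zero hc0 fun h => hlnP P (h ▸ P.ideal.zero_mem)
      · rw [map_mul, mul_assoc, hg, hcy]
  have key := finrank_le_tsum_deltaInvariant (k := k) (fun P : Γ.Point => Γ.localRing P) g
    (fun P a => isIntegral_localRing_of_mul (hln P) (hlnP P) (hsec P a) ((hg P a).symm ▸ hy a))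
    (fun P a => exists_fraction_of_mem_sectionsAt_bot (hl P) (hlP P) (hsec P a))
    -- If every germ is regular, `c` divides the combination of the `G i` locally at each closed
    -- point, hence globally because the degree is large; independence then forces `a = 0`.
    (fun a ha => hind a (exists_mem_grading_of_dvd hc (hGa a) (hn _ (hGa a) fun P => by
      obtain ⟨o, ho⟩ := ha P
      obtain ⟨i, b, hb, hbP, z, hz, hbz⟩ := mem_sectionsAt.mp
        (exists_algebraMap_eq_iff.mp ⟨o, ho.symm⟩)
      refine ⟨b, hbP, l P ^ n * z, FaithfulSMul.algebraMap_injective _ 𝕂 ?_⟩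
      rw [map_mul, ← hcy, ← hg P, map_mul, map_mul, ← hbz]
      ring)))
  rw [Module.finrank_fin_fun] at key
  exact key.trans_eq Γ.tsum_deltaAt

end ProjectiveCurve

/-! ### Normalising the denominator and conclusion -/

namespace ProjectiveCurve

/-- A form over `ℚ` has a rational multiple that is integral with nonzero reduction. -/
theorem exists_smul_eq_ofInt_of_ne_zero {r p : ℕ} [Fact p.Prime] {Γ : ProjectiveCurve ℚ r}
    {Γp : ProjectiveCurve (ZMod p) r} (hΓp : Γp.ideal = reductionMod Γ.ideal p) {e : ℕ}
    {c : Γ.coordinateRing} (hc : c ∈ Γ.grading e) (hc0 : c ≠ 0) :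
    ∃ (t : ℚ) (g : MvPolynomial (Fin (r + 1)) ℤ), g.IsHomogeneous e ∧ Γp.ofInt g ≠ 0 ∧
      Γ.ofInt g = algebraMap ℚ _ t * c := by
  obtain ⟨N, hN, f, hf, hNf⟩ := Γ.exists_smul_eq_ofInt hc
  have : CharZero Γ.coordinateRing := algebraRat.charZero _
  have hN' : ((N : ℤ) : Γ.coordinateRing) ≠ 0 := Int.cast_ne_zero.mpr hN
  have hf0 : Γ.ofInt f ≠ 0 := hNf ▸ mul_ne_zero hN' hc0
  obtain ⟨g, hg, hg0, j, hj⟩ := exists_ofInt_ne_zero hΓp hf hf0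
  have hp : ((p : ℚ) ^ j) ≠ 0 := pow_ne_zero j (Nat.cast_ne_zero.mpr (Fact.out : p.Prime).ne_zero)
  refine ⟨((p : ℚ) ^ j)⁻¹ * N, g, hg, hg0, ?_⟩
  have h1 : algebraMap ℚ Γ.coordinateRing ((p : ℚ) ^ j)⁻¹ * p ^ j = 1 := by
    rw [← map_natCast (algebraMap ℚ Γ.coordinateRing), ← map_pow, ← map_mul, inv_mul_cancel₀ hp,
      map_one]
  rw [map_mul, map_intCast, mul_assoc, hNf, hj, ← mul_assoc, h1, one_mul]

end ProjectiveCurve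

theorem mainTheorem8 (r : ℕ) (Γ : ProjectiveCurve ℚ r) (p : ℕ) [Fact p.Prime]
    (Γp : ProjectiveCurve (ZMod p) r) (hΓp : Γp.ideal = reductionMod Γ.ideal p) :
    Γ.delta ≤ Γp.delta := by
  rw [← Γ.tsum_deltaAt]
  -- Testing against natural numbers below finite partial sums also covers infinite values of `δ`.
  refine ENat.tsum_le_of_sum_le fun s => ENat.forall_natCast_le_iff_le.mp fun m hm => ?_
  obtain ⟨e, c, hc, hc0, hev⟩ := ProjectiveCurve.exists_sections_of_le_sum_deltaAt s m hm
  obtain ⟨t, f, hf, hf0, hfc⟩ :=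
    ProjectiveCurve.exists_smul_eq_ofInt_of_ne_zero hΓp hc hc0
  -- The denominator is fixed before `n`, so one degree can be large enough for both fibres.
  obtain ⟨n, ⟨w, hw, hcw⟩, hn⟩ := (hev.and (ProjectiveCurve.eventually_le_delta
    (Γp.ofInt_mem_grading hf) hf0)).exists
  obtain ⟨d, hmd, G, hG, hind, hdvd⟩ := ProjectiveCurve.exists_reduction hΓp hf hf0 w hw
    (fun a b hb j => by
      obtain ⟨y, hy, h⟩ := hcw a b hb j
      refine ⟨algebraMap ℚ _ t * y, ?_, by rw [hfc, map_mul, map_mul, mul_assoc, h]⟩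
      rw [← zero_add (e + j * n)]
      exact SetLike.GradedMul.mul_mem (SetLike.algebraMap_mem_graded _ t) hy)
  exact (Nat.cast_le.mpr hmd).trans (hn d G hG hind hdvd)
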